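/- For $n\ge 1$ write permutations of $[n]=\{1,\dots,n\}$ in one-row notation. A sequence $(\pi_n)_{n\ge1}$, $\pi_n=(\pi_{n1},\dots,\pi_{nn})\in\mathfrak S_n$, is coherent if for all $m\le n$ the permutations $\pi_m$ and $\pi_n$ determine the same order on $[m]$, i.e. $\pi_{nj}<\pi_{nk}\iff\pi_{mj}<\pi_{mk}$ for $j,k\le m$. A coherent sequence is determined by its initial ranks $i_n=\#\{k\le n:\pi_{nk}\le\pi_{nn}\}\in[n]$, and these may be prescribed arbitrarily. For $\theta,\zeta>0$ let $P^{(\theta,\zeta)}$ be the probability measure on the space of coherent sequences under which the initial ranks are independent, $i_1=1$, and, for $n\ge2$, $i_n$ takes the values $1$, $n$ and $r$ ($2\le r\le n-1$) with probabilities $$\frac{\theta}{\theta+\zeta+n-2},\qquad \frac{\zeta}{\theta+\zeta+n-2},\qquad \frac{1}{\theta+\zeta+n-2},$$ respectively. An entry $\pi_{nj}$ is a lower (upper) record of $\pi_n$ if it is the minimum (maximum) of $\pi_{n1},\dots,\pi_{nj}$. Let $r_0=\pi_{n1}$, let $r_1<r_2<\dots<r_u$ be the upper record values other than $r_0$ and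 $r_{-1}>r_{-2}>\dots>r_{-\ell}$ the lower record values other than $r_0$, and put $r_k=1$ for $k<-\ell$, $r_k=n$ for $k>u$. **Proposition 6.1.** Let $\theta,\zeta>0$. Under $P^{(\theta,\zeta)}$, as $n\to\infty$, the scaled record values of $\pi_n$ converge: there are random variables $\rho_k$ ($k\in\mathbb Z$) with $$\frac{r_k}{n}\to\rho_k\quad\text{a.s.}\qquad(k\in\mathbb Z).$$ The distribution of $\rho_0$ is beta$(\theta,\zeta)$. Given $\rho_0$, the sequences $(\rho_k,\,k<0)$ and $(\rho_k,\,k>0)$ are conditionally independent, and almost surely $$\rho_k=\rho_0\,T_kT_{k+1}\cdots T_{-1}\quad(k<0),\qquad \rho_k=1-(1-\rho_0)\,Z_1Z_2\cdots Z_k\quad(k>0),$$ where every $T_k$ ($k<0$) has the beta$(\theta,1)$ distribution, every $Z_k$ ($k>0$) has the beta$(\zeta,1)$ distribution, and the random variables $\rho_0$, $T_k$ ($k<0$), $Z_k$ ($k>0$) are all independent. -/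

import Mathlib

open MeasureTheory ProbabilityTheory Filter Topology

/-!
Conventions.  A permutation `σ` of `[n]` in one-row notation `(σ₁, …, σₙ)` is an element of
`Equiv.Perm (Fin n)`; the entry in position `j + 1` (`j : Fin n`) is `(σ j : ℕ) + 1`.
-/

/-- The power set is the σ-algebra on the finite set of permutations of `[n]`. -/
instance instMeasurableSpacePermFin (n : ℕ) : MeasurableSpace (Equiv.Perm (Fin n)) := ⊤

instance instDiscreteMeasurableSpacePermFin (n : ℕ) :
    DiscreteMeasurableSpace (Equiv.Perm (Fin n)) := ⟨fun _ => trivial⟩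

/-- `π_n ∈ 𝔖_n` and `π_m ∈ 𝔖_m`, `m ≤ n`, are coherent if they determine the same order
on `[m]`. -/
def Coherent {m n : ℕ} (h : m ≤ n) (τ : Equiv.Perm (Fin m)) (σ : Equiv.Perm (Fin n)) : Prop :=
  ∀ j k : Fin m, σ (Fin.castLE h j) < σ (Fin.castLE h k) ↔ τ j < τ k

/-- The space `𝔖^∞` of coherent sequences of permutations `(π_n)`, the projective limit of the
symmetric groups. -/
def CoherentPerms : Type :=
  {π : ∀ n : ℕ, Equiv.Perm (Fin n) // ∀ (m n : ℕ) (h : m ≤ n), Coherent h (π m) (π n)}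

/-- `𝔖^∞` carries the trace of the product σ-algebra. -/
instance instMeasurableSpaceCoherentPerms : MeasurableSpace CoherentPerms :=
  inferInstanceAs (MeasurableSpace
    {π : ∀ n : ℕ, Equiv.Perm (Fin n) // ∀ (m n : ℕ) (h : m ≤ n), Coherent h (π m) (π n)})

instance instStandardBorelSpaceCoherentPerms : StandardBorelSpace CoherentPerms := by
  have h : MeasurableSet {π : ∀ n : ℕ, Equiv.Perm (Fin n) |
      ∀ (m n : ℕ) (h : m ≤ n), Coherent h (π m) (π n)} := by
    have : {π : ∀ n : ℕ, Equiv.Perm (Fin n) | ∀ (m n : ℕ) (h : m ≤ n), Coherent h (π m) (π n)}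
        = ⋂ (m : ℕ) (n : ℕ) (h : m ≤ n),
          (fun π : ∀ n : ℕ, Equiv.Perm (Fin n) => (π m, π n)) ⁻¹'
            {p | Coherent h p.1 p.2} := by
      ext π; simp
    rw [this]
    refine MeasurableSet.iInter fun m => MeasurableSet.iInter fun n => MeasurableSet.iInter fun h =>
      ((measurable_pi_apply m).prodMk (measurable_pi_apply n)) (Set.to_countable _).measurableSet
  exact h.standardBorel

namespace CoherentPerms

/-- The permutation `π_n` of a coherent sequence. -/
def perm (π : CoherentPerms) (n : ℕ) : Equiv.Perm (Fin n) := π.1 n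

/-- The initial rank `i_{n+1} = #{k ≤ n + 1 : π_{n+1,k} ≤ π_{n+1,n+1}}` of the element `n + 1`. -/
def initialRank (π : CoherentPerms) (n : ℕ) : ℕ :=
  (Finset.univ.filter fun k : Fin (n + 1) => π.perm (n + 1) k ≤ π.perm (n + 1) (Fin.last n)).card

end CoherentPerms

/-- The permutations with prescribed initial ranks `i_1, i_2, …`, where `r n = i_{n+1} - 1`:
`π_{n+1}` has last entry `r n`, and its first `n` entries are those of `π_n` increased by one where
they are not smaller than the last entry. -/
def permOfRanks (r : ∀ n : ℕ, Fin (n + 1)) : ∀ n : ℕ, Equiv.Perm (Fin n)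
  | 0 => Equiv.refl _
  | n + 1 => finSuccEquivLast.trans
      ((permOfRanks r n).optionCongr.trans (finSuccEquiv' (r n)).symm)

theorem permOfRanks_last (r : ∀ n : ℕ, Fin (n + 1)) (n : ℕ) :
    permOfRanks r (n + 1) (Fin.last n) = r n := by
  simp [permOfRanks]

theorem permOfRanks_castSucc (r : ∀ n : ℕ, Fin (n + 1)) (n : ℕ) (j : Fin n) :
    permOfRanks r (n + 1) j.castSucc = (r n).succAbove (permOfRanks r n j) := by
  simp [permOfRanks]

theorem permOfRanks_coherent (r : ∀ n : ℕ, Fin (n + 1)) (m n : ℕ) (h : m ≤ n) :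
    Coherent h (permOfRanks r m) (permOfRanks r n) := by
  induction n, h using Nat.le_induction with
  | base => intro j k; rfl
  | succ n h ih =>
    intro j k
    have e : ∀ i : Fin m, Fin.castLE (h.trans n.le_succ) i = (Fin.castLE h i).castSucc :=
      fun _ => rfl
    rw [e, e, permOfRanks_castSucc, permOfRanks_castSucc, Fin.succAbove_lt_succAbove_iff]
    exact ih j k

/-- The coherent sequence of permutations with prescribed initial ranks. -/
def CoherentPerms.ofRanks (r : ∀ n : ℕ, Fin (n + 1)) : CoherentPerms :=
  ⟨permOfRanks r, permOfRanks_coherent r⟩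

theorem CoherentPerms.initialRank_ofRanks (r : ∀ n : ℕ, Fin (n + 1)) (n : ℕ) :
    (CoherentPerms.ofRanks r).initialRank n = (r n : ℕ) + 1 := by
  have e : ∀ n, (CoherentPerms.ofRanks r).perm n = permOfRanks r n := fun _ => rfl
  rw [CoherentPerms.initialRank, e, permOfRanks_last]
  have : (Finset.univ.filter fun k : Fin (n + 1) => permOfRanks r (n + 1) k ≤ r n)
      = (Finset.Iic (r n)).map (permOfRanks r (n + 1)).symm.toEmbedding := by
    ext k
    simp [Finset.mem_map_equiv]
  rw [this, Finset.card_map, Fin.card_Iic]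

theorem CoherentPerms.measurable_ofRanks : Measurable CoherentPerms.ofRanks := by
  refine Measurable.subtype_mk (measurable_pi_iff.2 fun n => ?_)
  induction n with
  | zero => exact measurable_const
  | succ n ih =>
    have : Measurable fun p : Equiv.Perm (Fin n) × Fin (n + 1) =>
        (finSuccEquivLast.trans (p.1.optionCongr.trans (finSuccEquiv' p.2).symm) :
          Equiv.Perm (Fin (n + 1))) := fun _ _ => (Set.to_countable _).measurableSet
    exact this.comp (ih.prodMk (measurable_pi_apply n))

/-- The weights of the values of the initial rank `i_{n+1}`, where `x : Fin (n + 1)` stands for the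
value `x + 1`: `i_1 = 1`, and for `n + 1 > 1` the probabilities of the values `1`, `n + 1` and of
any other value are `θ`, `ζ` and `1`, divided by `θ + ζ + (n + 1) - 2`. -/
noncomputable def rankWeight (θ ζ : ℝ) (n : ℕ) (x : Fin (n + 1)) : ℝ :=
  if n = 0 then 1
  else (if x = 0 then θ else if x = Fin.last n then ζ else 1) / (θ + ζ + ((n : ℝ) - 1))

theorem sum_rankWeight {θ ζ : ℝ} (hθ : 0 < θ) (hζ : 0 < ζ) (n : ℕ) :
    ∑ x, ENNReal.ofReal (rankWeight θ ζ n x) = 1 := by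
  rcases n with _ | n
  · simp [rankWeight]
  have hpos : 0 < θ + ζ + (((n + 1 : ℕ) : ℝ) - 1) := by
    have : (0 : ℝ) ≤ n := n.cast_nonneg
    push_cast
    linarith
  rw [← ENNReal.ofReal_sum_of_nonneg, ← ENNReal.ofReal_one]
  · congr 1
    simp only [rankWeight, Nat.succ_ne_zero, if_false]
    rw [← Finset.sum_div, div_eq_one_iff_eq hpos.ne', Fin.sum_univ_succ, Fin.sum_univ_castSucc]
    have h : ∀ x : Fin n, x.castSucc.succ ≠ Fin.last (n + 1) := fun x => by
      simpa [Fin.ext_iff] using x.2.ne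
    simp [h]
    ring
  · intro x _
    simp only [rankWeight, Nat.succ_ne_zero, if_false]
    refine div_nonneg ?_ hpos.le
    split_ifs <;> linarith

/-- The distribution of the initial rank `i_{n+1}` under `P^{(θ,ζ)}`. -/
noncomputable def rankLaw {θ ζ : ℝ} (hθ : 0 < θ) (hζ : 0 < ζ) (n : ℕ) : PMF (Fin (n + 1)) :=
  PMF.ofFintype (fun x => ENNReal.ofReal (rankWeight θ ζ n x)) (sum_rankWeight hθ hζ n)

/-- The measure `P^{(θ,ζ)}` on `𝔖^∞` under which the initial ranks are independent with the
distributions `rankLaw`. -/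
noncomputable def recordMeasure {θ ζ : ℝ} (hθ : 0 < θ) (hζ : 0 < ζ) : Measure CoherentPerms :=
  (Measure.infinitePi fun n => (rankLaw hθ hζ n).toMeasure).map CoherentPerms.ofRanks

instance instIsProbabilityMeasureRecordMeasure {θ ζ : ℝ} (hθ : 0 < θ) (hζ : 0 < ζ) :
    IsProbabilityMeasure (recordMeasure hθ hζ) :=
  Measure.isProbabilityMeasure_map CoherentPerms.measurable_ofRanks.aemeasurable

/-- The set of lower record values of `σ`: entries `σ_j = min(σ_1, …, σ_j)` (the center `σ_1`
included). -/
def lowerRecords {n : ℕ} (σ : Equiv.Perm (Fin n)) : Finset ℕ :=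
  (Finset.univ.filter fun j : Fin n => ∀ i ≤ j, σ j ≤ σ i).image fun j => (σ j : ℕ) + 1

/-- The set of upper record values of `σ`: entries `σ_j = max(σ_1, …, σ_j)` (the center `σ_1`
included). -/
def upperRecords {n : ℕ} (σ : Equiv.Perm (Fin n)) : Finset ℕ :=
  (Finset.univ.filter fun j : Fin n => ∀ i ≤ j, σ i ≤ σ j).image fun j => (σ j : ℕ) + 1

/-- The record values `r_k`, `k ∈ ℤ`, of a permutation of `[n]`.  The center is `r_0`, the smallest
upper and the largest lower record value; `r_1 < r_2 < ⋯` are the proper upper record values and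
`r_{-1} > r_{-2} > ⋯` the proper lower record values.  The two-sided sequence is padded by `1`s on
the left and by `n`s on the right. -/
def recordValue {n : ℕ} (σ : Equiv.Perm (Fin n)) : ℤ → ℕ
  | Int.ofNat k => ((upperRecords σ).sort (· ≤ ·)).getD k n
  | Int.negSucc k => ((lowerRecords σ).sort (· ≥ ·)).getD (k + 1) 1

/-! Let a_j be the number of elements below the j-th lower record and c_j the number above the j-th
upper record (j = 0 is the center), with value 0 for records that do not exist yet. Inserting an
element turns these counts into nested Pólya urns. The element falls below the center with weight θ
+ a_0 and above it with weight ζ + c_0. If it falls below the j-th lower record, it falls below the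
next one with weight θ + a_{j+1} and between the two with weight a_j − a_{j+1}. The upper side is
the mirror image, with ζ in place of θ.

In Bayesian terms, given the counts, the limits should be independent: the center beta(θ + a_0, ζ +
c_0), the j-th lower ratio beta(θ + a_{j+1}, a_j − a_{j+1}), or beta(θ, 1) while the next record is
missing. The proof verifies this guess at the level of moments. The product of the corresponding
beta moments is preserved on average by one insertion (`sum_recordMoment_step`), so it is a bounded
martingale for every choice of exponents (`martingale_momentProcess`).

Its first-moment cases are the ratios of shifted counts, so martingale convergence gives the limits.
For other exponents the beta moments tend to powers of the limits once the counts tend to infinity.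
The martingale starts at the product of the prior moments, so dominated convergence identifies all
mixed moments of the limits (`integral_prod_limits`). Laws on a cube are determined by mixed
moments, hence the limits are independent with the stated beta laws. Conditional independence given
the center follows, since the two sides are functions of the center and of independent families. -/

/-! ### Dynamics of the record counts under insertion. -/

/-- One step of the chain of the numbers `a j` of elements beyond the `j`-th record, when an element
with `x` elements beyond it is inserted. -/
def recordStep (x : ℕ) (a : ℕ → ℕ) (j : ℕ) : ℕ :=
  a j + if x ≤ a j ∧ (j = 0 ∨ a j < a (j - 1)) then 1 else 0

/-- One step of the chain of the list of the numbers of elements beyond the records. -/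
def recordListStep (x : ℕ) (l : List ℕ) : List ℕ :=
  l.map (fun a => a + if x ≤ a then 1 else 0) ++ if x = 0 then [0] else []

/-- Strictly decreasing lists ending in `0`. -/
def IsRecordList (l : List ℕ) : Prop := l.Pairwise (· > ·) ∧ ∃ l', l = l' ++ [0]

theorem isRecordList_singleton : IsRecordList [0] := ⟨by simp, [], rfl⟩

theorem IsRecordList.step {l : List ℕ} (hl : IsRecordList l) (x : ℕ) :
    IsRecordList (recordListStep x l) := by
  obtain ⟨h, l', rfl⟩ := hl
  have hmap : ((l' ++ [0]).map (fun a => a + if x ≤ a then 1 else 0)).Pairwise (· > ·) := by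
    refine List.pairwise_map.2 (h.imp ?_)
    intro a b hab
    split_ifs <;> omega
  by_cases hx : x = 0
  · subst hx
    refine ⟨?_, _, rfl⟩
    refine List.pairwise_append.2 ⟨hmap, by simp, ?_⟩
    intro a ha b hb
    obtain ⟨c, _, rfl⟩ := List.mem_map.1 ha
    simp at hb
    simp [hb]
  · refine ⟨by simpa [recordListStep, hx] using hmap,
      l'.map (fun a => a + if x ≤ a then 1 else 0), ?_⟩
    simp [recordListStep, hx]

theorem IsRecordList.getD_lt {l : List ℕ} (hl : IsRecordList l) {j : ℕ} (hj : j + 1 < l.length) :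
    l.getD (j + 1) 0 < l.getD j 0 := by
  rw [List.getD_eq_getElem _ _ hj, List.getD_eq_getElem _ _ (by omega)]
  exact List.pairwise_iff_getElem.1 hl.1 _ _ _ _ (by omega)

theorem IsRecordList.getD_eq_zero {l : List ℕ} (hl : IsRecordList l) {j : ℕ}
    (hj : l.length ≤ j + 1) : l.getD j 0 = 0 := by
  obtain ⟨h, l', rfl⟩ := hl
  simp at hj
  rcases hj.eq_or_lt with e | e
  · subst e; simp
  · exact List.getD_eq_default _ _ (by simpa using e)

/-- The extreme element is always a record, with nothing beyond it, so the list ends in 0 and a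
newly appended record has the same value 0 as the padding. In the padded sequence, the condition `a
j < a (j - 1)` therefore detects exactly whether the `j`-th record exists. -/
theorem IsRecordList.getD_step {l : List ℕ} (hl : IsRecordList l) (x j : ℕ) :
    (recordListStep x l).getD j 0 = recordStep x (fun i => l.getD i 0) j := by
  unfold recordStep
  by_cases hj : j < l.length
  · have h1 : j = 0 ∨ l.getD j 0 < l.getD (j - 1) 0 := by
      rcases j with _ | j
      · simp
      · exact Or.inr (hl.getD_lt hj)
    rw [recordListStep, List.getD_append _ _ _ _ (by simpa using hj),
      List.getD_eq_getElem _ _ (by simpa using hj), List.getElem_map]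
    simp only [h1, and_true]
    rw [List.getD_eq_getElem _ _ hj]
  · have hne : 0 < l.length := by
      obtain ⟨_, l', rfl⟩ := hl
      simp
    have h0 : ¬ (j = 0 ∨ l.getD j 0 < l.getD (j - 1) 0) := by
      rw [hl.getD_eq_zero (j := j - 1) (by omega)]
      omega
    simp only [h0, and_false, if_false]
    rw [hl.getD_eq_zero (j := j) (by omega), recordListStep,
      List.getD_append_right _ _ _ _ (by simpa using hj)]
    split_ifs
    · rcases h : j - (l.map fun a => a + if x ≤ a then 1 else 0).length with _ | k <;> simp
    · simp

/-! ### Record values of a permutation in terms of the counts. -/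

theorem castSucc_mem_lower_iff (r : ∀ n : ℕ, Fin (n + 1)) (n : ℕ) (j : Fin n) :
    (∀ i ≤ j.castSucc, permOfRanks r (n + 1) j.castSucc ≤ permOfRanks r (n + 1) i) ↔
      ∀ i ≤ j, permOfRanks r n j ≤ permOfRanks r n i := by
  constructor
  · intro h i hi
    have := h i.castSucc (by simpa using hi)
    rwa [permOfRanks_castSucc, permOfRanks_castSucc, Fin.succAbove_le_succAbove_iff] at this
  · intro h i hi
    rcases Fin.eq_castSucc_or_eq_last i with ⟨i, rfl⟩ | rfl
    · rw [permOfRanks_castSucc, permOfRanks_castSucc, Fin.succAbove_le_succAbove_iff]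
      exact h i (by simpa using hi)
    · exact absurd hi (by simp)

theorem castSucc_mem_upper_iff (r : ∀ n : ℕ, Fin (n + 1)) (n : ℕ) (j : Fin n) :
    (∀ i ≤ j.castSucc, permOfRanks r (n + 1) i ≤ permOfRanks r (n + 1) j.castSucc) ↔
      ∀ i ≤ j, permOfRanks r n i ≤ permOfRanks r n j := by
  constructor
  · intro h i hi
    have := h i.castSucc (by simpa using hi)
    rwa [permOfRanks_castSucc, permOfRanks_castSucc, Fin.succAbove_le_succAbove_iff] at this
  · intro h i hi
    rcases Fin.eq_castSucc_or_eq_last i with ⟨i, rfl⟩ | rfl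
    · rw [permOfRanks_castSucc, permOfRanks_castSucc, Fin.succAbove_le_succAbove_iff]
      exact h i (by simpa using hi)
    · exact absurd hi (by simp)

theorem val_permOfRanks_castSucc (r : ∀ n : ℕ, Fin (n + 1)) (n : ℕ) (j : Fin n) :
    (permOfRanks r (n + 1) j.castSucc : ℕ) =
      permOfRanks r n j + if (r n : ℕ) ≤ permOfRanks r n j then 1 else 0 := by
  rw [permOfRanks_castSucc, Fin.succAbove]
  simp only [Fin.lt_def, Fin.val_castSucc]
  split_ifs
  · omega
  · rw [Fin.val_castSucc, add_zero]
  · rw [Fin.val_succ]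
  · omega

theorem last_mem_lower_iff (r : ∀ n : ℕ, Fin (n + 1)) (n : ℕ) :
    (∀ i ≤ Fin.last n, permOfRanks r (n + 1) (Fin.last n) ≤ permOfRanks r (n + 1) i) ↔
      (r n : ℕ) = 0 := by
  rw [permOfRanks_last]
  constructor
  · intro h
    have := h ((permOfRanks r (n + 1)).symm 0) (Fin.le_last _)
    rw [Equiv.apply_symm_apply, Fin.le_def, Fin.val_zero] at this
    exact Nat.le_zero.1 this
  · intro h i _
    rw [Fin.le_def, h]
    exact Nat.zero_le _

theorem last_mem_upper_iff (r : ∀ n : ℕ, Fin (n + 1)) (n : ℕ) :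
    (∀ i ≤ Fin.last n, permOfRanks r (n + 1) i ≤ permOfRanks r (n + 1) (Fin.last n)) ↔
      (r n : ℕ) = n := by
  rw [permOfRanks_last]
  constructor
  · intro h
    have := h ((permOfRanks r (n + 1)).symm (Fin.last n)) (Fin.le_last _)
    rw [Equiv.apply_symm_apply, Fin.le_def, Fin.val_last] at this
    omega
  · intro h i _
    rw [Fin.le_def, h]
    omega

theorem mem_lowerRecords_succ (r : ∀ n : ℕ, Fin (n + 1)) (n v : ℕ) :
    v + 1 ∈ lowerRecords (permOfRanks r (n + 1)) ↔
      (∃ w, w + 1 ∈ lowerRecords (permOfRanks r n) ∧ v = w + if (r n : ℕ) ≤ w then 1 else 0) ∨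
        ((r n : ℕ) = 0 ∧ v = 0) := by
  simp only [lowerRecords, Finset.mem_image, Finset.mem_filter, Finset.mem_univ, true_and,
    Nat.add_right_cancel_iff]
  constructor
  · rintro ⟨j, hj, rfl⟩
    rcases Fin.eq_castSucc_or_eq_last j with ⟨j, rfl⟩ | rfl
    · exact Or.inl ⟨_, ⟨j, (castSucc_mem_lower_iff r n j).1 hj, rfl⟩,
        val_permOfRanks_castSucc r n j⟩
    · have := (last_mem_lower_iff r n).1 hj
      exact Or.inr ⟨this, by rw [permOfRanks_last, this]⟩
  · rintro (⟨w, ⟨j, hj, rfl⟩, rfl⟩ | ⟨h, rfl⟩)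
    · exact ⟨j.castSucc, (castSucc_mem_lower_iff r n j).2 hj, val_permOfRanks_castSucc r n j⟩
    · exact ⟨Fin.last n, (last_mem_lower_iff r n).2 h, by rw [permOfRanks_last, h]⟩

theorem mem_upperRecords_succ (r : ∀ n : ℕ, Fin (n + 1)) (n v : ℕ) :
    v + 1 ∈ upperRecords (permOfRanks r (n + 1)) ↔
      (∃ w, w + 1 ∈ upperRecords (permOfRanks r n) ∧ v = w + if (r n : ℕ) ≤ w then 1 else 0) ∨
        ((r n : ℕ) = n ∧ v = n) := by
  simp only [upperRecords, Finset.mem_image, Finset.mem_filter, Finset.mem_univ, true_and,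
    Nat.add_right_cancel_iff]
  constructor
  · rintro ⟨j, hj, rfl⟩
    rcases Fin.eq_castSucc_or_eq_last j with ⟨j, rfl⟩ | rfl
    · exact Or.inl ⟨_, ⟨j, (castSucc_mem_upper_iff r n j).1 hj, rfl⟩,
        val_permOfRanks_castSucc r n j⟩
    · have := (last_mem_upper_iff r n).1 hj
      exact Or.inr ⟨this, by rw [permOfRanks_last, this]⟩
  · rintro (⟨w, ⟨j, hj, rfl⟩, rfl⟩ | ⟨h, h'⟩)
    · exact ⟨j.castSucc, (castSucc_mem_upper_iff r n j).2 hj, val_permOfRanks_castSucc r n j⟩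
    · exact ⟨Fin.last n, (last_mem_upper_iff r n).2 h, by rw [permOfRanks_last, h, h']⟩

/-- The numbers of elements smaller than the lower records, at time `n + 1`. -/
def lowerList (r : ∀ n : ℕ, Fin (n + 1)) : ℕ → List ℕ
  | 0 => [0]
  | n + 1 => recordListStep (r (n + 1)) (lowerList r n)

/-- The numbers of elements greater than the upper records, at time `n + 1`. -/
def upperList (r : ∀ n : ℕ, Fin (n + 1)) : ℕ → List ℕ
  | 0 => [0]
  | n + 1 => recordListStep (n + 1 - r (n + 1)) (upperList r n)

theorem isRecordList_lowerList (r : ∀ n : ℕ, Fin (n + 1)) (n : ℕ) :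
    IsRecordList (lowerList r n) := by
  induction n with
  | zero => exact isRecordList_singleton
  | succ n ih => exact ih.step _

theorem isRecordList_upperList (r : ∀ n : ℕ, Fin (n + 1)) (n : ℕ) :
    IsRecordList (upperList r n) := by
  induction n with
  | zero => exact isRecordList_singleton
  | succ n ih => exact ih.step _

theorem mem_recordListStep {x v : ℕ} {l : List ℕ} :
    v ∈ recordListStep x l ↔ (∃ w ∈ l, v = w + if x ≤ w then 1 else 0) ∨ (x = 0 ∧ v = 0) := by
  rw [recordListStep, List.mem_append, List.mem_map]
  refine or_congr (by simp only [eq_comm]) ?_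
  split_ifs with h <;> simp [h]

theorem mem_lowerList (r : ∀ n : ℕ, Fin (n + 1)) (n v : ℕ) :
    v ∈ lowerList r n ↔ v + 1 ∈ lowerRecords (permOfRanks r (n + 1)) := by
  induction n generalizing v with
  | zero =>
    rw [mem_lowerRecords_succ]
    simp [lowerList, lowerRecords, Fin.val_eq_zero]
  | succ n ih =>
    rw [mem_lowerRecords_succ, lowerList, mem_recordListStep]
    simp only [ih]

theorem le_of_mem_upperRecords {n v : ℕ} {σ : Equiv.Perm (Fin n)} (h : v ∈ upperRecords σ) :
    1 ≤ v ∧ v ≤ n := by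
  simp only [upperRecords, Finset.mem_image] at h
  obtain ⟨j, -, rfl⟩ := h
  omega

theorem mem_upperList (r : ∀ n : ℕ, Fin (n + 1)) (n v : ℕ) :
    v ∈ upperList r n ↔ v ≤ n ∧ n - v + 1 ∈ upperRecords (permOfRanks r (n + 1)) := by
  induction n generalizing v with
  | zero =>
    rw [mem_upperRecords_succ]
    simp [upperList]
  | succ n ih =>
    rw [mem_upperRecords_succ, upperList, mem_recordListStep]
    simp only [ih]
    have hr : (r (n + 1) : ℕ) ≤ n + 1 := Nat.lt_succ_iff.1 (r (n + 1)).2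
    constructor
    · rintro (⟨w, ⟨hw, hw'⟩, rfl⟩ | ⟨h, rfl⟩)
      · refine ⟨by split_ifs <;> omega, Or.inl ⟨n - w, hw', ?_⟩⟩
        split_ifs <;> omega
      · exact ⟨by omega, Or.inr ⟨by omega, by omega⟩⟩
    · rintro ⟨hv, ⟨w, hw, h⟩ | ⟨h, h'⟩⟩
      · have := le_of_mem_upperRecords hw
        refine Or.inl ⟨n - w, ⟨by omega, ?_⟩, ?_⟩
        · rwa [show n - (n - w) = w by omega]
        · split_ifs at h ⊢ <;> omega
      · exact Or.inr ⟨by omega, by omega⟩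

theorem sort_lowerRecords (r : ∀ n : ℕ, Fin (n + 1)) (n : ℕ) :
    (lowerRecords (permOfRanks r (n + 1))).sort (· ≥ ·) = (lowerList r n).map (· + 1) := by
  have hp : ((lowerList r n).map (· + 1)).Pairwise (· > ·) :=
    List.pairwise_map.2 ((isRecordList_lowerList r n).1.imp fun h => by omega)
  have : lowerRecords (permOfRanks r (n + 1)) = ((lowerList r n).map (· + 1)).toFinset := by
    ext v
    rcases v with _ | v
    · simp [lowerRecords]
    · simp [mem_lowerList]
  rw [this]
  exact (List.toFinset_sort (r := (· ≥ ·)) (hp.imp fun h => ne_of_gt h)).2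
    (hp.imp fun h => le_of_lt h)

theorem sort_upperRecords (r : ∀ n : ℕ, Fin (n + 1)) (n : ℕ) :
    (upperRecords (permOfRanks r (n + 1))).sort (· ≤ ·) =
      (upperList r n).map (fun v => n + 1 - v) := by
  have hle : ∀ v ∈ upperList r n, v ≤ n := fun v hv => ((mem_upperList r n v).1 hv).1
  have hp : ((upperList r n).map (fun v => n + 1 - v)).Pairwise (· < ·) := by
    refine List.pairwise_map.2 ((isRecordList_upperList r n).1.imp_of_mem ?_)
    intro a b ha hb h
    have := hle a ha
    omega
  have : upperRecords (permOfRanks r (n + 1)) =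
      ((upperList r n).map (fun v => n + 1 - v)).toFinset := by
    ext v
    simp only [List.mem_toFinset, List.mem_map, mem_upperList]
    constructor
    · intro hv
      have := le_of_mem_upperRecords hv
      refine ⟨n + 1 - v, ⟨by omega, ?_⟩, by omega⟩
      rwa [show n - (n + 1 - v) + 1 = v by omega]
    · rintro ⟨w, ⟨h, h'⟩, rfl⟩
      rwa [show n + 1 - w = n - w + 1 by omega]
  rw [this]
  exact (List.toFinset_sort (r := (· ≤ ·)) (hp.imp fun h => ne_of_lt h)).2
    (hp.imp fun h => le_of_lt h)

/-- The number of elements smaller than the `j`-th lower record at time `n + 1`. -/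
def lowerCount (r : ∀ n : ℕ, Fin (n + 1)) : ℕ → ℕ → ℕ
  | 0 => fun _ => 0
  | n + 1 => recordStep (r (n + 1)) (lowerCount r n)

/-- The number of elements greater than the `j`-th upper record at time `n + 1`. -/
def upperCount (r : ∀ n : ℕ, Fin (n + 1)) : ℕ → ℕ → ℕ
  | 0 => fun _ => 0
  | n + 1 => recordStep (n + 1 - r (n + 1)) (upperCount r n)

theorem getD_lowerList (r : ∀ n : ℕ, Fin (n + 1)) (n j : ℕ) :
    (lowerList r n).getD j 0 = lowerCount r n j := by
  induction n generalizing j with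
  | zero => rcases j with _ | j <;> simp [lowerList, lowerCount]
  | succ n ih => simp only [lowerList, (isRecordList_lowerList r n).getD_step, ih, lowerCount]

theorem getD_upperList (r : ∀ n : ℕ, Fin (n + 1)) (n j : ℕ) :
    (upperList r n).getD j 0 = upperCount r n j := by
  induction n generalizing j with
  | zero => rcases j with _ | j <;> simp [upperList, upperCount]
  | succ n ih => simp only [upperList, (isRecordList_upperList r n).getD_step, ih, upperCount]

/-- Equal consecutive counts vanish: the corresponding record has not occurred yet. -/
def StrictUntilZero (a : ℕ → ℕ) : Prop := ∀ j, a (j + 1) < a j ∨ (a j = 0 ∧ a (j + 1) = 0)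

/-- If `a (j + 1)` increases, then `a j` is positive, hence strictly below its predecessor if it has
one, and increases too; strict inequalities thus survive. If both entries are 0, the second one
cannot move. -/
theorem StrictUntilZero.step {a : ℕ → ℕ} (ha : StrictUntilZero a) (x : ℕ) :
    StrictUntilZero (recordStep x a) := by
  intro j
  have h1 := ha j
  have h2 := ha (j - 1)
  rcases j with _ | j <;> simp only [recordStep, Nat.add_sub_cancel] at * <;> grind

theorem StrictUntilZero.antitone {a : ℕ → ℕ} (ha : StrictUntilZero a) : Antitone a :=
  antitone_nat_of_succ_le fun j => by have := ha j; omega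

theorem strictUntilZero_lowerCount (r : ∀ n : ℕ, Fin (n + 1)) (n : ℕ) :
    StrictUntilZero (lowerCount r n) := by
  induction n with
  | zero => intro j; simp [lowerCount]
  | succ n ih => exact ih.step _

theorem strictUntilZero_upperCount (r : ∀ n : ℕ, Fin (n + 1)) (n : ℕ) :
    StrictUntilZero (upperCount r n) := by
  induction n with
  | zero => intro j; simp [upperCount]
  | succ n ih => exact ih.step _

theorem lowerCount_add_upperCount (r : ∀ n : ℕ, Fin (n + 1)) (n : ℕ) :
    lowerCount r n 0 + upperCount r n 0 = n := by
  induction n with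
  | zero => simp [lowerCount, upperCount]
  | succ n ih =>
    have hr : (r (n + 1) : ℕ) ≤ n + 1 := Nat.lt_succ_iff.1 (r (n + 1)).2
    simp only [lowerCount, upperCount, recordStep, true_or, and_true]
    split_ifs <;> omega

/-- The two paddings agree: a missing upper record has value `n + 1` and count 0. -/
theorem recordValue_nonneg (r : ∀ n : ℕ, Fin (n + 1)) (n k : ℕ) :
    recordValue (permOfRanks r (n + 1)) (k : ℤ) + upperCount r n k = n + 1 := by
  have hle : ∀ v ∈ upperList r n, v ≤ n := fun v hv => ((mem_upperList r n v).1 hv).1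
  change ((upperRecords (permOfRanks r (n + 1))).sort (· ≤ ·)).getD k (n + 1) + _ = _
  rw [sort_upperRecords, ← getD_upperList]
  by_cases hk : k < (upperList r n).length
  · rw [List.getD_eq_getElem _ _ (by simpa using hk), List.getD_eq_getElem _ _ hk,
      List.getElem_map]
    have := hle _ (List.getElem_mem hk)
    omega
  · rw [List.getD_eq_default _ _ (by simpa using hk), List.getD_eq_default _ _ (by simpa using hk)]

theorem recordValue_neg (r : ∀ n : ℕ, Fin (n + 1)) (n k : ℕ) :
    recordValue (permOfRanks r (n + 1)) (-((k : ℤ) + 1)) = lowerCount r n (k + 1) + 1 := by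
  rw [← Int.negSucc_eq]
  change ((lowerRecords (permOfRanks r (n + 1))).sort (· ≥ ·)).getD (k + 1) 1 = _
  rw [sort_lowerRecords, ← getD_lowerList]
  by_cases hk : k + 1 < (lowerList r n).length
  · rw [List.getD_eq_getElem _ _ (by simpa using hk), List.getD_eq_getElem _ _ hk,
      List.getElem_map]
  · rw [List.getD_eq_default _ _ (by simpa using hk), List.getD_eq_default _ _ (by simpa using hk)]

/-! ### Beta moments and the urn identities. -/

/-- The `p`-th moment of the beta distribution with parameters `α`, `β`. -/
noncomputable def betaMoment (α β : ℝ) (p : ℕ) : ℝ :=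
  ∏ i ∈ Finset.range p, (α + i) / (α + β + i)

/-- Size-biasing a beta(α, β) variable X gives beta(α + 1, β); both sides express the moment of
order `p + 1` of X. -/
theorem betaMoment_add_one_left {α β : ℝ} (hs : 0 < α + β) (p : ℕ) :
    α * betaMoment (α + 1) β p * (α + β + p) = (α + β) * (α + p) * betaMoment α β p := by
  induction p with
  | zero => simp [betaMoment]; ring
  | succ p ih =>
    have h1 : α + β + p ≠ 0 := by positivity
    have h2 : α + 1 + β + p ≠ 0 := by
      have : α + 1 + β + p = α + β + p + 1 := by ring
      rw [this]; positivity
    simp only [betaMoment, Finset.prod_range_succ] at ih ⊢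
    generalize ∏ i ∈ Finset.range p, (α + 1 + (i : ℝ)) / (α + 1 + β + i) = A at *
    generalize ∏ i ∈ Finset.range p, (α + (i : ℝ)) / (α + β + i) = B at *
    push_cast
    field_simp
    linear_combination (α + 1 + β + p) * (α + 1 + p) * ih

theorem betaMoment_add_one_right {α β : ℝ} (hs : 0 < α + β) (p : ℕ) :
    betaMoment α (β + 1) p * (α + β + p) = (α + β) * betaMoment α β p := by
  induction p with
  | zero => simp [betaMoment]
  | succ p ih =>
    have h1 : α + β + p ≠ 0 := by positivity
    have h2 : α + (β + 1) + p ≠ 0 := by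
      have : α + (β + 1) + p = α + β + p + 1 := by ring
      rw [this]; positivity
    simp only [betaMoment, Finset.prod_range_succ] at ih ⊢
    generalize ∏ i ∈ Finset.range p, (α + (i : ℝ)) / (α + (β + 1) + i) = A at *
    generalize ∏ i ∈ Finset.range p, (α + (i : ℝ)) / (α + β + i) = B at *
    push_cast
    field_simp
    linear_combination (α + (β + 1) + p) * (α + p) * ih

/-- This is the expectation of X^p = X·X^p + (1 − X)·X^p for X beta(α, β): one draw of a Pólya urn
preserves the posterior moment on average. -/
theorem betaMoment_urn {α β : ℝ} (hs : 0 < α + β) (p : ℕ) :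
    α * betaMoment (α + 1) β p + β * betaMoment α (β + 1) p = (α + β) * betaMoment α β p := by
  have h1 : α + β + p ≠ 0 := by positivity
  have h2 := betaMoment_add_one_left hs p
  have h3 := betaMoment_add_one_right hs p
  refine mul_right_cancel₀ h1 ?_
  linear_combination h2 + β * h3

theorem betaMoment_mem_Icc {α β : ℝ} (hα : 0 < α) (hβ : 0 ≤ β) (p : ℕ) :
    betaMoment α β p ∈ Set.Icc (0 : ℝ) 1 := by
  refine ⟨Finset.prod_nonneg fun i _ => by positivity, Finset.prod_le_one
    (fun i _ => by positivity) fun i _ => ?_⟩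
  rw [div_le_one (by positivity)]
  linarith

@[simp] theorem betaMoment_zero (α β : ℝ) : betaMoment α β 0 = 1 := by simp [betaMoment]

@[simp] theorem betaMoment_one (α β : ℝ) : betaMoment α β 1 = α / (α + β) := by
  simp [betaMoment]

/-- The conditional mixed moment of the ratios of successive records, given counts `a`. -/
noncomputable def ratioMoment (θ : ℝ) (K : ℕ) (P : ℕ → ℕ) (a : ℕ → ℕ) : ℝ :=
  ∏ j ∈ Finset.range K, betaMoment (θ + a (j + 1)) ((max (a j - a (j + 1)) 1 : ℕ) : ℝ) (P j)

theorem ratioMoment_succ (θ : ℝ) (K : ℕ) (P : ℕ → ℕ) (a : ℕ → ℕ) :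
    ratioMoment θ (K + 1) P a = betaMoment (θ + a 1) ((max (a 0 - a 1) 1 : ℕ) : ℝ) (P 0) *
      ratioMoment θ K (fun j => P (j + 1)) (fun j => a (j + 1)) := by
  rw [ratioMoment, Finset.prod_range_succ', mul_comm]
  rfl

theorem ratioMoment_mem_Icc {θ : ℝ} (hθ : 0 < θ) (K : ℕ) (P a : ℕ → ℕ) :
    ratioMoment θ K P a ∈ Set.Icc (0 : ℝ) 1 := by
  have h : ∀ j, betaMoment (θ + a (j + 1)) ((max (a j - a (j + 1)) 1 : ℕ) : ℝ) (P j) ∈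
      Set.Icc (0 : ℝ) 1 := fun j => betaMoment_mem_Icc (by positivity) (by positivity) _
  exact ⟨Finset.prod_nonneg fun j _ => (h j).1,
    Finset.prod_le_one (fun j _ => (h j).1) fun j _ => (h j).2⟩

theorem StrictUntilZero.tail {a : ℕ → ℕ} (ha : StrictUntilZero a) :
    StrictUntilZero (fun j => a (j + 1)) := fun j => ha (j + 1)

theorem recordStep_tail_of_lt {a : ℕ → ℕ} (h : a 1 < a 0) (x : ℕ) :
    (fun j => recordStep x a (j + 1)) = recordStep x (fun j => a (j + 1)) := by
  funext j
  rcases j with _ | j <;> simp [recordStep, h]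

theorem recordStep_eq_self_of_lt {a : ℕ → ℕ} (ha : Antitone a) {x : ℕ} (h : a 0 < x) :
    recordStep x a = a := by
  funext j
  have := ha (Nat.zero_le j)
  rw [recordStep, if_neg (by omega), add_zero]

/-- One-sided averaging, by induction on the number of ratios. Values x ≤ a_1 (total weight θ + a_1)
act on the tail as a full one-sided step; the a_0 − a_1 larger values leave the tail alone. The urn
identity with parameters θ + a_1 and a_0 − a_1 recombines the two contributions. -/
theorem sum_ratioMoment_recordStep {θ : ℝ} (hθ : 0 < θ) (K : ℕ) (P : ℕ → ℕ) {a : ℕ → ℕ}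
    (ha : StrictUntilZero a) :
    ∑ x ∈ Finset.range (a 0 + 1), (if x = 0 then θ else 1) * ratioMoment θ K P (recordStep x a) =
      (θ + a 0) * ratioMoment θ K P a := by
  have hw : ∀ m : ℕ, ∑ x ∈ Finset.range (m + 1), (if x = 0 then θ else 1) = θ + m := fun m => by
    rw [Finset.sum_range_succ']
    simp [add_comm]
  induction K generalizing P a with
  | zero => simp [ratioMoment, hw]
  | succ K ih =>
    rcases ha 0 with h | ⟨h0, h1⟩
    · rw [zero_add] at h
      have hsplit : a 0 + 1 = (a 1 + 1) + (a 0 - a 1) := by omega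
      have hI : ∀ x ∈ Finset.range (a 1 + 1), (if x = 0 then θ else 1) *
          ratioMoment θ (K + 1) P (recordStep x a) =
          betaMoment (θ + a 1 + 1) (a 0 - a 1) (P 0) * ((if x = 0 then θ else 1) *
            ratioMoment θ K (fun j => P (j + 1)) (recordStep x fun j => a (j + 1))) := by
        intro x hx
        have hx' : x ≤ a 1 := Nat.lt_succ_iff.1 (Finset.mem_range.1 hx)
        have e0 : recordStep x a 0 = a 0 + 1 := by
          rw [recordStep, if_pos ⟨by omega, Or.inl rfl⟩]
        have e1 : recordStep x a 1 = a 1 + 1 := by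
          rw [recordStep, if_pos ⟨by omega, Or.inr h⟩]
        rw [ratioMoment_succ, recordStep_tail_of_lt h, e0, e1,
          show max (a 0 + 1 - (a 1 + 1)) 1 = a 0 - a 1 by omega, Nat.cast_sub h.le]
        push_cast
        rw [add_assoc]
        ring
      have hJ : ∀ x ∈ Finset.range (a 0 - a 1), (if a 1 + 1 + x = 0 then θ else 1) *
          ratioMoment θ (K + 1) P (recordStep (a 1 + 1 + x) a) =
          betaMoment (θ + a 1) (a 0 - a 1 + 1) (P 0) *
            ratioMoment θ K (fun j => P (j + 1)) (fun j => a (j + 1)) := by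
        intro x hx
        have hx' := Finset.mem_range.1 hx
        have e0 : recordStep (a 1 + 1 + x) a 0 = a 0 + 1 := by
          rw [recordStep, if_pos ⟨by omega, Or.inl rfl⟩]
        have e : (fun j => recordStep (a 1 + 1 + x) a (j + 1)) = fun j => a (j + 1) := by
          rw [recordStep_tail_of_lt h, recordStep_eq_self_of_lt ha.tail.antitone]
          simp only [zero_add]
          omega
        have e1 : recordStep (a 1 + 1 + x) a 1 = a 1 := congrFun e 0
        rw [ratioMoment_succ, e, e0, e1, if_neg (by omega), one_mul,
          show max (a 0 + 1 - a 1) 1 = (a 0 - a 1) + 1 by omega]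
        push_cast [Nat.cast_sub h.le]
        rfl
      rw [hsplit, Finset.sum_range_add, Finset.sum_congr rfl hI, Finset.sum_congr rfl hJ,
        ← Finset.mul_sum, ih _ ha.tail, Finset.sum_const, Finset.card_range, nsmul_eq_mul,
        ratioMoment_succ, show max (a 0 - a 1) 1 = a 0 - a 1 by omega, Nat.cast_sub h.le]
      have hlt : (a 1 : ℝ) < a 0 := by exact_mod_cast h
      have h1 : (0 : ℝ) ≤ a 1 := Nat.cast_nonneg _
      have := betaMoment_urn (α := θ + a 1) (β := a 0 - a 1) (by linarith) (P 0)
      simp only [zero_add]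
      linear_combination
        ratioMoment θ K (fun j => P (j + 1)) (fun j => a (j + 1)) * this
    -- No later record exists, so x = 0 creates one and only `a 0` changes, from 0 to 1. The maximum
    -- with 1 makes the second beta parameter 1 both before and after, so the moment does not
    -- change.
    · have hz : ∀ j, a j = 0 := fun j => Nat.le_zero.1 (h0 ▸ ha.antitone (Nat.zero_le j))
      have e : ∀ j, recordStep 0 a (j + 1) = a (j + 1) := fun j => by simp [recordStep, hz]
      have e0 : recordStep 0 a 0 = 1 := by simp [recordStep, hz]
      rw [h0, Finset.sum_range_one, if_pos rfl, ratioMoment_succ, ratioMoment_succ]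
      simp [e, e0, hz]

/-- The conditional mixed moment of the limits of the records, given counts `a` and `c`. -/
noncomputable def recordMoment (θ ζ : ℝ) (K p : ℕ) (P Q : ℕ → ℕ) (a c : ℕ → ℕ) : ℝ :=
  betaMoment (θ + a 0) (ζ + c 0) p * ratioMoment θ K P a * ratioMoment ζ K Q c

theorem recordMoment_mem_Icc {θ ζ : ℝ} (hθ : 0 < θ) (hζ : 0 < ζ) (K p : ℕ) (P Q a c : ℕ → ℕ) :
    recordMoment θ ζ K p P Q a c ∈ Set.Icc (0 : ℝ) 1 := by
  have h1 := betaMoment_mem_Icc (α := θ + a 0) (β := ζ + c 0) (by positivity) (by positivity) p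
  have h2 := ratioMoment_mem_Icc hθ K P a
  have h3 := ratioMoment_mem_Icc hζ K Q c
  exact ⟨mul_nonneg (mul_nonneg h1.1 h2.1) h3.1,
    mul_le_one₀ (mul_le_one₀ h1.2 h2.1 h2.2) h3.1 h3.2⟩

/-- The a_0 + 1 smallest ranks affect only the lower counts, the other c_0 + 1 only the upper ones.
On each side the one-sided average applies, and the urn identity for the center joins the sides. -/
theorem sum_recordMoment_step {θ ζ : ℝ} (hθ : 0 < θ) (hζ : 0 < ζ) (K p : ℕ) (P Q : ℕ → ℕ)
    {a c : ℕ → ℕ} (ha : StrictUntilZero a) (hc : StrictUntilZero c) {n : ℕ} (hn : a 0 + c 0 = n) :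
    ∑ x : Fin (n + 2), rankWeight θ ζ (n + 1) x *
      recordMoment θ ζ K p P Q (recordStep x a) (recordStep (n + 1 - x) c) =
        recordMoment θ ζ K p P Q a c := by
  have hs : (0 : ℝ) < θ + ζ + n := by positivity
  have hw : ∀ x : Fin (n + 2), rankWeight θ ζ (n + 1) x =
      (if (x : ℕ) = 0 then θ else if (x : ℕ) = n + 1 then ζ else 1) / (θ + ζ + n) := by
    intro x
    have h0 : (x = 0) = ((x : ℕ) = 0) := propext Fin.ext_iff
    have h1 : (x = Fin.last (n + 1)) = ((x : ℕ) = n + 1) := propext Fin.ext_iff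
    rw [rankWeight, if_neg n.succ_ne_zero]
    simp only [h0, h1]
    push_cast
    rw [add_sub_cancel_right]
  simp only [hw, div_mul_eq_mul_div]
  rw [← Finset.sum_div, div_eq_iff hs.ne',
    Fin.sum_univ_eq_sum_range (fun x => (if x = 0 then θ else if x = n + 1 then ζ else 1) *
      recordMoment θ ζ K p P Q (recordStep x a) (recordStep (n + 1 - x) c)) (n + 2),
    show n + 2 = (a 0 + 1) + (c 0 + 1) by omega, Finset.sum_range_add,
    -- After reflection the upper block is indexed by the number of elements above the new one,
    -- matching the one-sided sum.
    ← Finset.sum_range_reflect _ (c 0 + 1)]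
  have hI : ∀ x ∈ Finset.range (a 0 + 1), (if x = 0 then θ else if x = n + 1 then ζ else 1) *
      recordMoment θ ζ K p P Q (recordStep x a) (recordStep (n + 1 - x) c) =
      betaMoment (θ + a 0 + 1) (ζ + c 0) p * ratioMoment ζ K Q c *
        ((if x = 0 then θ else 1) * ratioMoment θ K P (recordStep x a)) := by
    intro x hx
    have hx' : x ≤ a 0 := Nat.lt_succ_iff.1 (Finset.mem_range.1 hx)
    have e0 : recordStep x a 0 = a 0 + 1 := by
      rw [recordStep, if_pos ⟨by omega, Or.inl rfl⟩]
    rw [recordStep_eq_self_of_lt hc.antitone (x := n + 1 - x) (by omega), recordMoment, e0,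
      if_neg (show x ≠ n + 1 by omega)]
    push_cast
    rw [add_assoc θ]
    ring
  have hJ : ∀ x ∈ Finset.range (c 0 + 1), (if a 0 + 1 + (c 0 + 1 - 1 - x) = 0 then θ else
      if a 0 + 1 + (c 0 + 1 - 1 - x) = n + 1 then ζ else 1) *
      recordMoment θ ζ K p P Q (recordStep (a 0 + 1 + (c 0 + 1 - 1 - x)) a)
        (recordStep (n + 1 - (a 0 + 1 + (c 0 + 1 - 1 - x))) c) =
      betaMoment (θ + a 0) (ζ + c 0 + 1) p * ratioMoment θ K P a *
        ((if x = 0 then ζ else 1) * ratioMoment ζ K Q (recordStep x c)) := by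
    intro x hx
    have hx' : x ≤ c 0 := Nat.lt_succ_iff.1 (Finset.mem_range.1 hx)
    have e0 : recordStep x c 0 = c 0 + 1 := by
      rw [recordStep, if_pos ⟨by omega, Or.inl rfl⟩]
    rw [recordStep_eq_self_of_lt ha.antitone (x := a 0 + 1 + (c 0 + 1 - 1 - x)) (by omega),
      show n + 1 - (a 0 + 1 + (c 0 + 1 - 1 - x)) = x by omega, recordMoment, e0,
      if_neg (show a 0 + 1 + (c 0 + 1 - 1 - x) ≠ 0 by omega)]
    have : (a 0 + 1 + (c 0 + 1 - 1 - x) = n + 1) = (x = 0) := by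
      apply propext; omega
    simp only [this]
    push_cast
    rw [add_assoc ζ]
    ring
  rw [Finset.sum_congr rfl hI, Finset.sum_congr rfl hJ, ← Finset.mul_sum, ← Finset.mul_sum,
    sum_ratioMoment_recordStep hθ K P ha, sum_ratioMoment_recordStep hζ K Q hc, recordMoment]
  have := betaMoment_urn (α := θ + a 0) (β := ζ + c 0) (by positivity) p
  have hn' : (n : ℝ) = a 0 + c 0 := by exact_mod_cast hn.symm
  rw [hn']
  linear_combination ratioMoment θ K P a * ratioMoment ζ K Q c * this

/-! ### The moment martingale. -/

/-- The law of the sequence of (zero-based) initial ranks. -/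
noncomputable def ranksMeasure {θ ζ : ℝ} (hθ : 0 < θ) (hζ : 0 < ζ) :
    Measure (∀ n : ℕ, Fin (n + 1)) :=
  Measure.infinitePi fun n => (rankLaw hθ hζ n).toMeasure

instance instIsProbabilityMeasureRanksMeasure {θ ζ : ℝ} (hθ : 0 < θ) (hζ : 0 < ζ) :
    IsProbabilityMeasure (ranksMeasure hθ hζ) := by
  unfold ranksMeasure; infer_instance

/-- Such a function factors through finitely many finite coordinates, a countable discrete space on
which everything is measurable; the remaining coordinates may be filled with 0. -/
theorem stronglyMeasurable_piLE_of_eq_of_le {f : (∀ n : ℕ, Fin (n + 1)) → ℝ} {n : ℕ}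
    (h : ∀ ω ω' : ∀ n : ℕ, Fin (n + 1), (∀ i ≤ n, ω i = ω' i) → f ω = f ω') :
    StronglyMeasurable[Filtration.piLE (X := fun n : ℕ => Fin (n + 1)) n] f := by
  refine Measurable.stronglyMeasurable ?_
  let g : (∀ i : Finset.Iic n, Fin ((i : ℕ) + 1)) → ℝ := fun y =>
    f fun i => if hi : i ∈ Finset.Iic n then y ⟨i, hi⟩ else 0
  have hf : f = g ∘ Preorder.frestrictLe (π := fun n : ℕ => Fin (n + 1)) n := by
    funext ω
    refine h _ _ fun i hi => ?_
    rw [dif_pos (Finset.mem_Iic.2 hi)]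
    rfl
  rw [hf, Filtration.piLE_eq_comap_frestrictLe]
  exact (measurable_of_countable g).comp (comap_measurable _)

theorem lowerCount_congr {ω ω' : ∀ n : ℕ, Fin (n + 1)} {n : ℕ} (h : ∀ i ≤ n, ω i = ω' i) :
    lowerCount ω n = lowerCount ω' n := by
  induction n with
  | zero => rfl
  | succ n ih => rw [lowerCount, lowerCount, ih fun i hi => h i (by omega), h _ le_rfl]

theorem upperCount_congr {ω ω' : ∀ n : ℕ, Fin (n + 1)} {n : ℕ} (h : ∀ i ≤ n, ω i = ω' i) :
    upperCount ω n = upperCount ω' n := by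
  induction n with
  | zero => rfl
  | succ n ih => rw [upperCount, upperCount, ih fun i hi => h i (by omega), h _ le_rfl]

/-- The conditional moments of the limits of the records given the first `n + 1` ranks. -/
noncomputable def momentProcess (θ ζ : ℝ) (K p : ℕ) (P Q : ℕ → ℕ) (n : ℕ)
    (ω : ∀ n : ℕ, Fin (n + 1)) : ℝ :=
  recordMoment θ ζ K p P Q (lowerCount ω n) (upperCount ω n)

theorem momentProcess_mem_Icc {θ ζ : ℝ} (hθ : 0 < θ) (hζ : 0 < ζ) (K p : ℕ)
    (P Q : ℕ → ℕ) (n : ℕ) (ω : ∀ n : ℕ, Fin (n + 1)) :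
    momentProcess θ ζ K p P Q n ω ∈ Set.Icc (0 : ℝ) 1 :=
  recordMoment_mem_Icc hθ hζ _ _ _ _ _ _

theorem measurableSet_eval_eq (n : ℕ) (x : Fin (n + 1)) :
    MeasurableSet {ω : ∀ n : ℕ, Fin (n + 1) | ω n = x} :=
  (measurableSet_singleton x).preimage (measurable_pi_apply n)

section
variable {θ ζ : ℝ} (hθ : 0 < θ) (hζ : 0 < ζ) (K p : ℕ) (P Q : ℕ → ℕ)

theorem indep_comap_eval_piLE (n : ℕ) :
    Indep (MeasurableSpace.comap (fun ω : ∀ n : ℕ, Fin (n + 1) => ω (n + 1)) inferInstance)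
      (Filtration.piLE (X := fun n : ℕ => Fin (n + 1)) n) (ranksMeasure hθ hζ) := by
  have h : iIndepFun (fun i (ω : ∀ n : ℕ, Fin (n + 1)) => ω i) (ranksMeasure hθ hζ) :=
    iIndepFun_infinitePi (X := fun i x => x) fun i => measurable_id
  have h2 := h.indepFun_finset {n + 1} (Finset.Iic n) (by simp) fun i => measurable_pi_apply i
  have h3 := h2.comp (measurable_pi_apply ⟨n + 1, Finset.mem_singleton_self _⟩) measurable_id
  rw [Filtration.piLE_eq_comap_frestrictLe]
  exact h3

theorem condExp_indicator_eval (n : ℕ) (x : Fin (n + 2)) :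
    (ranksMeasure hθ hζ)[Set.indicator {ω | ω (n + 1) = x} (fun _ => (1 : ℝ)) |
      Filtration.piLE (X := fun n : ℕ => Fin (n + 1)) n] =ᵐ[ranksMeasure hθ hζ]
        fun _ => rankWeight θ ζ (n + 1) x := by
  have hm : MeasurableSet {ω : ∀ n : ℕ, Fin (n + 1) | ω (n + 1) = x} :=
    measurableSet_eval_eq (n + 1) x
  have h1 := condExp_indep_eq (μ := ranksMeasure hθ hζ)
    (f := Set.indicator {ω : ∀ n : ℕ, Fin (n + 1) | ω (n + 1) = x} (fun _ => (1 : ℝ)))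
    (measurable_pi_apply (n + 1)).comap_le
    (Filtration.piLE.le n) ?_ (indep_comap_eval_piLE hθ hζ n)
  · refine h1.trans (Eventually.of_forall fun _ => ?_)
    have h2 : ranksMeasure hθ hζ {ω | ω (n + 1) = x} = rankLaw hθ hζ (n + 1) x := by
      have h3 : (ranksMeasure hθ hζ).map (fun ω => ω (n + 1)) =
        (rankLaw hθ hζ (n + 1)).toMeasure := Measure.infinitePi_map_eval _ (n + 1)
      rw [← PMF.toMeasure_apply_singleton _ x (measurableSet_singleton x), ← h3,
        Measure.map_apply (measurable_pi_apply (n + 1)) (measurableSet_singleton x)]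
      rfl
    have hw : 0 ≤ rankWeight θ ζ (n + 1) x := by
      rw [rankWeight, if_neg n.succ_ne_zero]
      push_cast
      rw [add_sub_cancel_right]
      split_ifs <;> positivity
    simp only [integral_indicator_const _ hm, measureReal_def, h2]
    simp [rankLaw, hw]
  · refine Measurable.stronglyMeasurable ?_
    refine Measurable.indicator measurable_const ?_
    exact ⟨{x}, measurableSet_singleton x, rfl⟩

theorem stronglyMeasurable_momentProcess (n : ℕ) :
    StronglyMeasurable[Filtration.piLE (X := fun n : ℕ => Fin (n + 1)) n]
      (momentProcess θ ζ K p P Q n) :=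
  stronglyMeasurable_piLE_of_eq_of_le fun ω ω' h => by
    rw [momentProcess, momentProcess, lowerCount_congr h, upperCount_congr h]

theorem integrable_of_mem_Icc {Ω : Type*} [MeasurableSpace Ω] {μ : Measure Ω} [IsFiniteMeasure μ]
    {f : Ω → ℝ} (hf : Measurable f) (h : ∀ ω, f ω ∈ Set.Icc (0 : ℝ) 1) : Integrable f μ :=
  Integrable.of_bound hf.aestronglyMeasurable 1 (Eventually.of_forall fun ω => by
    rw [Real.norm_eq_abs, abs_of_nonneg (h ω).1]
    exact (h ω).2)

theorem measurable_momentProcess (n : ℕ) : Measurable (momentProcess θ ζ K p P Q n) :=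
  ((stronglyMeasurable_momentProcess K p P Q n).mono (Filtration.piLE.le n)).measurable

theorem martingale_momentProcess :
    Martingale (momentProcess θ ζ K p P Q) (Filtration.piLE (X := fun n : ℕ => Fin (n + 1)))
      (ranksMeasure hθ hζ) := by
  refine martingale_nat (stronglyMeasurable_momentProcess K p P Q) (fun n =>
    integrable_of_mem_Icc (measurable_momentProcess K p P Q n)
      (momentProcess_mem_Icc hθ hζ K p P Q n)) fun n => ?_
  let Y : Fin (n + 2) → (∀ n : ℕ, Fin (n + 1)) → ℝ := fun x ω =>
    recordMoment θ ζ K p P Q (recordStep x (lowerCount ω n)) (recordStep (n + 1 - x)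
      (upperCount ω n))
  let I : Fin (n + 2) → (∀ n : ℕ, Fin (n + 1)) → ℝ := fun x =>
    Set.indicator {ω | ω (n + 1) = x} fun _ => 1
  have hY : ∀ x, StronglyMeasurable[Filtration.piLE (X := fun n : ℕ => Fin (n + 1)) n] (Y x) :=
    fun x => stronglyMeasurable_piLE_of_eq_of_le fun ω ω' h => by
      simp only [Y, lowerCount_congr h, upperCount_congr h]
  have hYb : ∀ x ω, Y x ω ∈ Set.Icc (0 : ℝ) 1 := fun x ω => recordMoment_mem_Icc hθ hζ _ _ _ _ _ _
  have hI : ∀ x, Integrable (I x) (ranksMeasure hθ hζ) := fun x =>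
    (integrable_const 1).indicator (measurableSet_eval_eq (n + 1) x)
  have hYI : ∀ x, Integrable (Y x * I x) (ranksMeasure hθ hζ) := fun x =>
    (hI x).bdd_mul (c := 1) ((hY x).mono (Filtration.piLE.le n)).aestronglyMeasurable
      (Eventually.of_forall fun ω => by
        rw [Real.norm_eq_abs, abs_of_nonneg (hYb x ω).1]
        exact (hYb x ω).2)
  -- Splitting by the value of the next rank leaves factors `Y x` known at time `n`, which leave the
  -- conditional expectation, and indicators independent of the past.
  have hsum : momentProcess θ ζ K p P Q (n + 1) = ∑ x, Y x * I x := by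
    funext ω
    rw [Finset.sum_apply, Finset.sum_eq_single (ω (n + 1))]
    · simp [Y, I, momentProcess, lowerCount, upperCount]
    · intro x _ hx
      simp [I, hx.symm]
    · simp
  rw [hsum]
  refine EventuallyEq.trans ?_ (condExp_finsetSum (fun x _ => hYI x) _).symm
  have hx : ∀ᵐ ω ∂(ranksMeasure hθ hζ), ∀ x, ((ranksMeasure hθ hζ)[Y x * I x |
      Filtration.piLE (X := fun n : ℕ => Fin (n + 1)) n]) ω =
      Y x ω * rankWeight θ ζ (n + 1) x := by
    rw [ae_all_iff]
    intro x
    filter_upwards [condExp_mul_of_stronglyMeasurable_left (hY x) (hYI x) (hI x),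
      condExp_indicator_eval hθ hζ n x] with ω h1 h2
    rw [h1, Pi.mul_apply, h2]
  filter_upwards [hx] with ω hω
  rw [Finset.sum_apply, Finset.sum_congr rfl fun x _ => hω x, momentProcess,
    ← sum_recordMoment_step hθ hζ K p P Q (strictUntilZero_lowerCount ω n)
      (strictUntilZero_upperCount ω n) (lowerCount_add_upperCount ω n)]
  exact Finset.sum_congr rfl fun x _ => mul_comm _ _

theorem integral_momentProcess (n : ℕ) :
    ∫ ω, momentProcess θ ζ K p P Q n ω ∂(ranksMeasure hθ hζ) =
      recordMoment θ ζ K p P Q (fun _ => 0) (fun _ => 0) := by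
  have h := (martingale_momentProcess hθ hζ K p P Q).setIntegral_eq (Nat.zero_le n)
    MeasurableSet.univ
  rw [setIntegral_univ, setIntegral_univ] at h
  rw [← h]
  have : ∀ ω, momentProcess θ ζ K p P Q 0 ω =
      recordMoment θ ζ K p P Q (fun _ => 0) (fun _ => 0) := fun ω => rfl
  simp [this]

theorem exists_tendsto_momentProcess :
    ∀ᵐ ω ∂(ranksMeasure hθ hζ),
      ∃ c, Tendsto (fun n => momentProcess θ ζ K p P Q n ω) atTop (𝓝 c) := by
  refine (martingale_momentProcess hθ hζ K p P Q).submartingale.exists_ae_tendsto_of_bdd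
    (R := 1) fun n => ?_
  have := eLpNorm_le_of_ae_bound (p := 1) (μ := ranksMeasure hθ hζ)
    (f := momentProcess θ ζ K p P Q n) (C := 1)
    (Eventually.of_forall fun ω => by
      have h := momentProcess_mem_Icc hθ hζ K p P Q n ω
      rw [Real.norm_eq_abs, abs_of_nonneg h.1]
      exact h.2)
  simpa using this

end

/-! ### Moments and support of the beta distribution. -/

theorem measurable_betaPDF (α β : ℝ) : Measurable (betaPDF α β) :=
  (measurable_betaPDFReal α β).ennreal_ofReal

theorem toReal_betaPDF {α β : ℝ} (hα : 0 < α) (hβ : 0 < β) (x : ℝ) :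
    (betaPDF α β x).toReal = betaPDFReal α β x := by
  refine ENNReal.toReal_ofReal ?_
  by_cases h : 0 < x ∧ x < 1
  · exact (betaPDFReal_pos h.1 h.2 hα hβ).le
  · rw [betaPDFReal, if_neg h]

theorem integral_betaMeasure {α β : ℝ} (hα : 0 < α) (hβ : 0 < β) (g : ℝ → ℝ) :
    ∫ x, g x ∂(betaMeasure α β) = ∫ x, betaPDFReal α β x * g x := by
  rw [betaMeasure, integral_withDensity_eq_integral_toReal_smul
    (measurable_betaPDF α β) (ae_of_all _ fun x => ENNReal.ofReal_lt_top)]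
  simp only [toReal_betaPDF hα hβ, smul_eq_mul]

theorem betaPDFReal_mul_self {α β : ℝ} (hα : 0 < α) (hβ : 0 < β) (x : ℝ) :
    betaPDFReal α β x * x = α / (α + β) * betaPDFReal (α + 1) β x := by
  unfold betaPDFReal
  split_ifs with h
  · have hx : x ^ (α + 1 - 1) = x ^ (α - 1) * x := by
      rw [← Real.rpow_add_one h.1.ne']
      ring_nf
    have hb : beta (α + 1) β = α / (α + β) * beta α β := by
      have h1 : Real.Gamma (α + β) ≠ 0 := (Real.Gamma_pos_of_pos (by positivity)).ne'
      have h2 : α + β ≠ 0 := by positivity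
      rw [beta, beta, Real.Gamma_add_one hα.ne', show α + 1 + β = α + β + 1 by ring,
        Real.Gamma_add_one h2]
      field_simp
    have h3 : beta α β ≠ 0 := (beta_pos hα hβ).ne'
    have h2 : α + β ≠ 0 := by positivity
    rw [hx, hb]
    field_simp
  · simp

theorem integral_pow_betaMeasure {α β : ℝ} (hα : 0 < α) (hβ : 0 < β) (p : ℕ) :
    ∫ x, x ^ p ∂(betaMeasure α β) = betaMoment α β p := by
  induction p generalizing α with
  | zero =>
    have := isProbabilityMeasureBeta hα hβ
    simp
  | succ p ih =>
    have h := ih (α := α + 1) (by positivity)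
    rw [integral_betaMeasure (by positivity) hβ] at h
    rw [integral_betaMeasure hα hβ, betaMoment, Finset.prod_range_succ', mul_comm (∏ _ ∈ _, _)]
    have e : ∀ x, betaPDFReal α β x * x ^ (p + 1) =
        α / (α + β) * (betaPDFReal (α + 1) β x * x ^ p) := fun x => by
      rw [pow_succ', ← mul_assoc, betaPDFReal_mul_self hα hβ, mul_assoc]
    simp only [e, integral_const_mul, h, betaMoment]
    congr 1
    · simp
    · refine Finset.prod_congr rfl fun i _ => ?_
      push_cast
      congr 1 <;> ring

theorem ae_mem_Ioo_betaMeasure (α β : ℝ) : ∀ᵐ x ∂(betaMeasure α β), x ∈ Set.Ioo (0 : ℝ) 1 := by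
  rw [betaMeasure, ae_withDensity_iff (measurable_betaPDF α β)]
  refine ae_of_all _ fun x hx => ?_
  by_contra h
  exact hx (by rw [betaPDF_eq, if_neg (show ¬ (0 < x ∧ x < 1) from h), ENNReal.ofReal_zero])

/-! ### Measures on a cube are determined by their mixed moments. -/

section Moments

open BoundedContinuousFunction

variable {ι : Type*}

/-- Polynomial functions on the cube. -/
def cubePolynomials (ι : Type*) : StarSubalgebra ℝ ((ι → unitInterval) →ᵇ ℝ) where
  carrier := {g | ∃ p : MvPolynomial ι ℝ, ∀ x, g x = MvPolynomial.eval (fun i => (x i : ℝ)) p}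
  mul_mem' := by
    rintro f g ⟨p, hp⟩ ⟨q, hq⟩
    exact ⟨p * q, fun x => by simp [hp, hq]⟩
  add_mem' := by
    rintro f g ⟨p, hp⟩ ⟨q, hq⟩
    exact ⟨p + q, fun x => by simp [hp, hq]⟩
  algebraMap_mem' r := ⟨MvPolynomial.C r, fun x => by simp⟩
  star_mem' := by
    rintro f ⟨p, hp⟩
    exact ⟨p, fun x => by simp [hp]⟩

theorem separatesPoints_cubePolynomials :
    ((cubePolynomials ι).map (toContinuousMapStarₐ ℝ)).SeparatesPoints := by
  intro x y hxy
  obtain ⟨i, hi⟩ := Function.ne_iff.1 hxy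
  let f : (ι → unitInterval) →ᵇ ℝ := BoundedContinuousFunction.mkOfCompact
    ⟨fun x => (x i : ℝ), by fun_prop⟩
  refine ⟨fun x => (x i : ℝ), ⟨toContinuousMapStarₐ ℝ f, ⟨f, ⟨MvPolynomial.X i, fun x => ?_⟩, rfl⟩,
    rfl⟩, ?_⟩
  · simp [f]
  · simpa [Subtype.ext_iff] using hi

theorem integral_eval_cube (μ : Measure (ι → unitInterval)) [IsFiniteMeasure μ]
    (p : MvPolynomial ι ℝ) :
    ∫ x, MvPolynomial.eval (fun i => (x i : ℝ)) p ∂μ =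
      ∑ d ∈ p.support, p.coeff d * ∫ x, ∏ i ∈ d.support, (x i : ℝ) ^ d i ∂μ := by
  simp only [MvPolynomial.eval_eq]
  rw [integral_finsetSum]
  · simp only [integral_const_mul]
  · intro d _
    refine Integrable.const_mul (integrable_of_mem_Icc (by fun_prop) fun x => ?_) _
    exact ⟨Finset.prod_nonneg fun i _ => pow_nonneg (x i).2.1 _,
      Finset.prod_le_one (fun i _ => pow_nonneg (x i).2.1 _)
        fun i _ => pow_le_one₀ (x i).2.1 (x i).2.2⟩

/-- Stone–Weierstrass: polynomials form a point-separating subalgebra, and by linearity their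
integrals are fixed by those of the monomials. -/
theorem measure_cube_ext_of_moments [Countable ι] {μ ν : Measure (ι → unitInterval)}
    [IsFiniteMeasure μ] [IsFiniteMeasure ν]
    (h : ∀ d : ι →₀ ℕ, ∫ x, ∏ i ∈ d.support, (x i : ℝ) ^ d i ∂μ =
      ∫ x, ∏ i ∈ d.support, (x i : ℝ) ^ d i ∂ν) : μ = ν := by
  refine ext_of_forall_mem_subalgebra_integral_eq_of_polish (𝕜 := ℝ)
    (A := cubePolynomials ι) separatesPoints_cubePolynomials ?_
  rintro g ⟨p, hp⟩
  simp only [hp, integral_eval_cube, h]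

/-- Probability measures concentrated on the unit cube are determined by their mixed moments. -/
theorem measure_ext_of_moments [Countable ι] {μ ν : Measure (ι → ℝ)}
    [IsFiniteMeasure μ] [IsFiniteMeasure ν]
    (hμ : ∀ᵐ x ∂μ, ∀ i, x i ∈ Set.Icc (0 : ℝ) 1) (hν : ∀ᵐ x ∂ν, ∀ i, x i ∈ Set.Icc (0 : ℝ) 1)
    (h : ∀ d : ι →₀ ℕ, ∫ x, ∏ i ∈ d.support, x i ^ d i ∂μ =
      ∫ x, ∏ i ∈ d.support, x i ^ d i ∂ν) : μ = ν := by
  -- Clamping to the cube and embedding back is almost surely the identity, so nothing is lost by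
  -- pushing the measures to the compact cube.
  let P : (ι → ℝ) → ι → unitInterval := fun x i => Set.projIcc 0 1 zero_le_one (x i)
  let E : (ι → unitInterval) → ι → ℝ := fun x i => x i
  have hP : Measurable P := by
    refine measurable_pi_iff.2 fun i => ?_
    exact (continuous_projIcc.comp (continuous_apply i)).measurable
  have hE : Measurable E := by fun_prop
  have key : ∀ {τ : Measure (ι → ℝ)}, (∀ᵐ x ∂τ, ∀ i, x i ∈ Set.Icc (0 : ℝ) 1) →
      E ∘ P =ᵐ[τ] id := fun hτ => by
    filter_upwards [hτ] with x hx
    funext i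
    simp [E, P, Set.projIcc_of_mem zero_le_one (hx i)]
  have back : ∀ {τ : Measure (ι → ℝ)}, (∀ᵐ x ∂τ, ∀ i, x i ∈ Set.Icc (0 : ℝ) 1) →
      (τ.map P).map E = τ := fun hτ => by
    rw [Measure.map_map hE hP, Measure.map_congr (key hτ), Measure.map_id]
  have int : ∀ {τ : Measure (ι → ℝ)}, (∀ᵐ x ∂τ, ∀ i, x i ∈ Set.Icc (0 : ℝ) 1) →
      ∀ d : ι →₀ ℕ, ∫ x, ∏ i ∈ d.support, (x i : ℝ) ^ d i ∂(τ.map P) =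
        ∫ x, ∏ i ∈ d.support, x i ^ d i ∂τ := fun {τ} hτ d => by
    have hm : Measurable fun x : ι → unitInterval => ∏ i ∈ d.support, (x i : ℝ) ^ d i := by
      fun_prop
    rw [integral_map hP.aemeasurable hm.aestronglyMeasurable]
    refine integral_congr_ae ?_
    filter_upwards [key hτ] with x hx
    refine Finset.prod_congr rfl fun i _ => ?_
    rw [show ((P x i : unitInterval) : ℝ) = x i from congrFun hx i]
  rw [← back hμ, ← back hν, measure_cube_ext_of_moments (μ := μ.map P) (ν := ν.map P)
    fun d => by rw [int hμ, int hν, h]]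

theorem integral_prod_infinitePi {ν : ι → Measure ℝ} [∀ i, IsProbabilityMeasure (ν i)]
    (s : Finset ι) (e : ι → ℕ) :
    ∫ x, ∏ i ∈ s, x i ^ e i ∂(Measure.infinitePi ν) = ∏ i ∈ s, ∫ x, x ^ e i ∂(ν i) := by
  have h1 : ∀ x : ι → ℝ, ∏ i ∈ s, x i ^ e i = ∏ i : s, (s.restrict x i) ^ e i := fun x =>
    (Finset.prod_attach s fun i => x i ^ e i).symm
  have h2 := integral_restrict_infinitePi (μ := ν) (s := s)
    (f := fun y : s → ℝ => ∏ i : s, y i ^ e i)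
    (Measurable.aestronglyMeasurable (by fun_prop))
  simp only [h1]
  rw [h2, integral_fintype_prod_eq_prod (fun (i : s) (x : ℝ) => x ^ e i)]
  exact Finset.prod_attach s fun i => ∫ x, x ^ e i ∂(ν i)

end Moments

/-! ### Conditional independence from independence. -/

section CondIndep

variable {Ω δ γ β ε : Type*} [MeasurableSpace Ω] [MeasurableSpace δ] [MeasurableSpace γ]
  [MeasurableSpace β] [MeasurableSpace ε] {μ : Measure Ω} [IsProbabilityMeasure μ]

theorem map_prodMk_eq_compProd_of_indepFun {W : Ω → δ} {R : Ω → β} (hW : Measurable W)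
    (hR : Measurable R) (h : IndepFun W R μ) {φ : δ → γ} (hφ : Measurable φ) {F : γ × β → ε}
    (hF : Measurable F) (η : Kernel δ ε) [IsMarkovKernel η]
    (hη : ∀ w, η w = (μ.map R).map fun r => F (φ w, r)) :
    μ.map (fun ω => (W ω, F (φ (W ω), R ω))) = μ.map W ⊗ₘ η := by
  have hprob := Measure.isProbabilityMeasure_map (μ := μ) hR.aemeasurable
  have hprobW := Measure.isProbabilityMeasure_map (μ := μ) hW.aemeasurable
  have hmap : μ.map (fun ω => (W ω, R ω)) = (μ.map W).prod (μ.map R) :=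
    (indepFun_iff_map_prod_eq_prod_map_map hW.aemeasurable hR.aemeasurable).1 h
  have hG : Measurable fun p : δ × β => (p.1, F (φ p.1, p.2)) := by fun_prop
  have e : μ.map (fun ω => (W ω, F (φ (W ω), R ω))) =
      ((μ.map W).prod (μ.map R)).map fun p : δ × β => (p.1, F (φ p.1, p.2)) := by
    rw [← hmap, Measure.map_map hG (hW.prodMk hR)]
    rfl
  ext s hs
  rw [e, Measure.map_apply hG hs, Measure.prod_apply (hG hs), Measure.compProd_apply hs]
  refine lintegral_congr fun w => ?_
  rw [hη, Measure.map_apply (by fun_prop) (measurable_prodMk_left hs)]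
  rfl

/-- If `R` is independent of `(k, S)`, then functions of `(k, S)` and of `(k, R)` are
conditionally independent given `k`. -/
theorem condIndepFun_of_indepFun_prodMk [StandardBorelSpace Ω] {α ε' : Type*} [MeasurableSpace α]
    [MeasurableSpace ε'] [StandardBorelSpace ε] [Nonempty ε] [StandardBorelSpace ε'] [Nonempty ε']
    {k : Ω → γ} {S : Ω → α} {R : Ω → β} (hk : Measurable k) (hS : Measurable S) (hR : Measurable R)
    (h : IndepFun (fun ω => (k ω, S ω)) R μ) {G : γ × α → ε'} (hG : Measurable G)
    {F : γ × β → ε} (hF : Measurable F) :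
    CondIndepFun (MeasurableSpace.comap k inferInstance) hk.comap_le
      (fun ω => G (k ω, S ω)) (fun ω => F (k ω, R ω)) μ := by
  have hprob := Measure.isProbabilityMeasure_map (μ := μ) hR.aemeasurable
  have hf : Measurable fun ω => F (k ω, R ω) := hF.comp (hk.prodMk hR)
  have hg : Measurable fun ω => G (k ω, S ω) := hG.comp (hk.prodMk hS)
  -- The law of F(c, R) for fixed c. It serves as conditional law both given `k` and given `k`
  -- together with `G`; not depending on the latter is the conditional independence.
  let κ : Kernel γ ε := (Kernel.id ×ₖ Kernel.const γ (μ.map R)).map F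
  have hκM : IsMarkovKernel κ := Kernel.IsMarkovKernel.map _ hF
  have hκ : ∀ c, κ c = (μ.map R).map fun r => F (c, r) := fun c => by
    rw [Kernel.map_apply _ hF, Kernel.prod_apply, Kernel.id_apply, Kernel.const_apply,
      Measure.dirac_prod, Measure.map_map hF measurable_prodMk_left]
    rfl
  have hkR : IndepFun k R μ := h.comp measurable_fst measurable_id
  have hgR : IndepFun (fun ω => (k ω, G (k ω, S ω))) R μ :=
    h.comp (φ := fun p => (p.1, G p)) (measurable_fst.prodMk hG) measurable_id
  have h1 : condDistrib (fun ω => F (k ω, R ω)) k μ =ᵐ[μ.map k] κ := by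
    rw [condDistrib_ae_eq_iff_measure_eq_compProd k hf.aemeasurable]
    exact map_prodMk_eq_compProd_of_indepFun hk hR hkR measurable_id hF κ hκ
  have h2 : condDistrib (fun ω => F (k ω, R ω)) (fun ω => (k ω, G (k ω, S ω))) μ
      =ᵐ[μ.map fun ω => (k ω, G (k ω, S ω))] κ.prodMkRight ε' := by
    rw [condDistrib_ae_eq_iff_measure_eq_compProd _ hf.aemeasurable]
    exact map_prodMk_eq_compProd_of_indepFun (hk.prodMk hg) hR hgR measurable_fst hF _
      fun w => by rw [Kernel.prodMkRight_apply, hκ]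
  rw [condIndepFun_iff_condDistrib_prod_ae_eq_prodMkRight hf hg hk]
  refine h2.trans ?_
  have h3 : μ.map k = (μ.map fun ω => (k ω, G (k ω, S ω))).map Prod.fst := by
    rw [Measure.map_map measurable_fst (hk.prodMk hg)]
    rfl
  rw [h3] at h1
  filter_upwards [ae_of_ae_map measurable_fst.aemeasurable h1] with w hw
  rw [Kernel.prodMkRight_apply, Kernel.prodMkRight_apply, hw]

end CondIndep

/-! ### Identification of limit laws and growth of the counts. -/

theorem measure_ext_of_pow_moments {μ ν : Measure ℝ} [IsFiniteMeasure μ] [IsFiniteMeasure ν]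
    (hμ : ∀ᵐ x ∂μ, x ∈ Set.Icc (0 : ℝ) 1) (hν : ∀ᵐ x ∂ν, x ∈ Set.Icc (0 : ℝ) 1)
    (h : ∀ p : ℕ, ∫ x, x ^ p ∂μ = ∫ x, x ^ p ∂ν) : μ = ν := by
  let e : ℝ → Unit → ℝ := fun x _ => x
  have he : Measurable e := by fun_prop
  have back : ∀ τ : Measure ℝ, (τ.map e).map (fun y => y ()) = τ := fun τ => by
    rw [Measure.map_map (by fun_prop) he]
    exact Measure.map_id
  have hs : MeasurableSet {x : Unit → ℝ | ∀ i, x i ∈ Set.Icc (0 : ℝ) 1} := by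
    rw [Set.ofPred_forall]
    exact MeasurableSet.iInter fun i => measurableSet_Icc.preimage (measurable_pi_apply i)
  have int : ∀ (τ : Measure ℝ) (d : Unit →₀ ℕ), ∫ x, ∏ i ∈ d.support, x i ^ d i ∂(τ.map e) =
      ∫ x, x ^ d () ∂τ := fun τ d => by
    have hm : Measurable fun x : Unit → ℝ => ∏ i ∈ d.support, x i ^ d i := by fun_prop
    rw [integral_map he.aemeasurable hm.aestronglyMeasurable]
    refine integral_congr_ae (Eventually.of_forall fun x => ?_)
    change d.prod (fun _ m => x ^ m) = _
    rw [Finsupp.prod_fintype _ _ (by simp)]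
    simp
  have key : μ.map e = ν.map e := by
    refine measure_ext_of_moments ?_ ?_ fun d => by rw [int, int, h]
    · rw [ae_map_iff he.aemeasurable hs]
      filter_upwards [hμ] with x hx _ using hx
    · rw [ae_map_iff he.aemeasurable hs]
      filter_upwards [hν] with x hx _ using hx
  rw [← back μ, ← back ν, key]

/-- A beta law with mean tending to t and parameter sum tending to infinity concentrates at t: each
of the `p` factors of its moment tends to t. -/
theorem tendsto_betaMoment {A B : ℕ → ℝ} {t : ℝ}
    (hlim : Tendsto (fun n => A n / (A n + B n)) atTop (𝓝 t))
    (hs : Tendsto (fun n => A n + B n) atTop atTop) (p : ℕ) :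
    Tendsto (fun n => betaMoment (A n) (B n) p) atTop (𝓝 (t ^ p)) := by
  have h : ∀ i ∈ Finset.range p,
      Tendsto (fun n => (A n + (i : ℝ)) / (A n + B n + i)) atTop (𝓝 t) := fun i _ => by
    have h1 : Tendsto (fun n => (i : ℝ) / (A n + B n)) atTop (𝓝 0) := hs.const_div_atTop _
    have h2 := (hlim.add h1).div (h1.const_add 1) (by norm_num)
    rw [add_zero, add_zero, div_one] at h2
    refine h2.congr' ?_
    filter_upwards [hs.eventually_gt_atTop 0] with n hn
    simp only [Pi.div_apply]
    field_simp
  have := tendsto_finsetProd _ h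
  simpa [betaMoment] using this

section Law

variable {Ω : Type*} [MeasurableSpace Ω] {μ : Measure Ω} [IsProbabilityMeasure μ]

/-- The integrals in `hint` do not depend on `n`, while their integrands converge boundedly to
powers of `T`; so `T` has the moments of beta(α, β). -/
theorem map_eq_betaMeasure_of_tendsto {A B : ℕ → Ω → ℝ} {T : Ω → ℝ} {α β : ℝ} (hα : 0 < α)
    (hβ : 0 < β) (hT : Measurable T) (hA : ∀ n ω, 0 < A n ω) (hB : ∀ n ω, 0 ≤ B n ω)
    (hm : ∀ p n, Measurable fun ω => betaMoment (A n ω) (B n ω) p)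
    (hlim : ∀ᵐ ω ∂μ, Tendsto (fun n => A n ω / (A n ω + B n ω)) atTop (𝓝 (T ω)))
    (hs : ∀ᵐ ω ∂μ, Tendsto (fun n => A n ω + B n ω) atTop atTop)
    (hint : ∀ p n, ∫ ω, betaMoment (A n ω) (B n ω) p ∂μ = betaMoment α β p) :
    μ.map T = betaMeasure α β := by
  have := isProbabilityMeasureBeta hα hβ
  have := Measure.isProbabilityMeasure_map (μ := μ) hT.aemeasurable
  refine measure_ext_of_pow_moments ?_ ?_ fun p => ?_
  · refine (ae_map_iff hT.aemeasurable measurableSet_Icc).2 ?_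
    filter_upwards [hlim] with ω h
    refine isClosed_Icc.mem_of_tendsto h (Eventually.of_forall fun n => ?_)
    have := betaMoment_mem_Icc (hA n ω) (hB n ω) 1
    rwa [betaMoment_one] at this
  · filter_upwards [ae_mem_Ioo_betaMeasure α β] with x hx using Set.Ioo_subset_Icc_self hx
  · have hpm : Measurable fun x : ℝ => x ^ p := by fun_prop
    rw [integral_map hT.aemeasurable hpm.aestronglyMeasurable, integral_pow_betaMeasure hα hβ]
    refine tendsto_nhds_unique (f := fun n : ℕ => ∫ ω, betaMoment (A n ω) (B n ω) p ∂μ)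
      (l := atTop) ?_ ?_
    · refine tendsto_integral_of_dominated_convergence (fun _ => 1)
        (fun n => (hm p n).aestronglyMeasurable) (integrable_const 1)
        (fun n => Eventually.of_forall fun ω => ?_) ?_
      · have h := betaMoment_mem_Icc (hA n ω) (hB n ω) p
        rw [Real.norm_eq_abs, abs_of_nonneg h.1]
        exact h.2
      · filter_upwards [hlim, hs] with ω h1 h2 using tendsto_betaMoment h1 h2 p
    · simp only [hint]
      exact tendsto_const_nhds

/-- The conditional expectation of the ratio of the `k`-th and the `k + 1`-st record. -/
noncomputable def meanRatio (θ : ℝ) (a : ℕ → ℕ) (k : ℕ) : ℝ :=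
  (θ + a (k + 1)) / (θ + a (k + 1) + ((max (a k - a (k + 1)) 1 : ℕ) : ℝ))

/-- The two claims feed each other: divergence of the k-th count yields the beta law of `T k`, which
has no mass at 0, and a positive limiting ratio makes the next count diverge. -/
theorem tendsto_count_and_map_eq_betaMeasure {θ : ℝ} (hθ : 0 < θ) {a : ℕ → Ω → ℕ → ℕ}
    {T : ℕ → Ω → ℝ} (hT : ∀ k, Measurable (T k))
    (hm : ∀ k p n, Measurable fun ω =>
      betaMoment (θ + a n ω (k + 1)) ((max (a n ω k - a n ω (k + 1)) 1 : ℕ) : ℝ) p)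
    (hlim : ∀ k, ∀ᵐ ω ∂μ, Tendsto (fun n => meanRatio θ (a n ω) k) atTop (𝓝 (T k ω)))
    (hint : ∀ k p n, ∫ ω,
      betaMoment (θ + a n ω (k + 1)) ((max (a n ω k - a n ω (k + 1)) 1 : ℕ) : ℝ) p ∂μ =
        betaMoment θ 1 p)
    (h0 : ∀ᵐ ω ∂μ, Tendsto (fun n => a n ω 0) atTop atTop) (k : ℕ) :
    (∀ᵐ ω ∂μ, Tendsto (fun n => a n ω k) atTop atTop) ∧ μ.map (T k) = betaMeasure θ 1 := by
  have sum_tendsto : ∀ k ω, Tendsto (fun n => a n ω k) atTop atTop →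
      Tendsto (fun n => θ + a n ω (k + 1) + ((max (a n ω k - a n ω (k + 1)) 1 : ℕ) : ℝ))
        atTop atTop := fun k ω h => by
    refine tendsto_atTop_mono (fun n => ?_) (tendsto_natCast_atTop_atTop.comp h)
    have : a n ω k ≤ a n ω (k + 1) + max (a n ω k - a n ω (k + 1)) 1 := by omega
    have h2 : ((a n ω k : ℕ) : ℝ) ≤ (a n ω (k + 1) : ℝ) +
      ((max (a n ω k - a n ω (k + 1)) 1 : ℕ) : ℝ) := by exact_mod_cast this
    simp only [Function.comp_apply]
    linarith
  have law : ∀ k, (∀ᵐ ω ∂μ, Tendsto (fun n => a n ω k) atTop atTop) →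
      μ.map (T k) = betaMeasure θ 1 := fun k h =>
    map_eq_betaMeasure_of_tendsto hθ one_pos (hT k) (fun n ω => by positivity)
      (fun n ω => by positivity) (hm k) (hlim k)
      (by filter_upwards [h] with ω hω using sum_tendsto k ω hω) (hint k)
  suffices h : ∀ᵐ ω ∂μ, Tendsto (fun n => a n ω k) atTop atTop from ⟨h, law k h⟩
  induction k with
  | zero => exact h0
  | succ k ih =>
    have hpos : ∀ᵐ ω ∂μ, 0 < T k ω := by
      refine ae_of_ae_map (p := fun x => 0 < x) (hT k).aemeasurable ?_
      rw [law k ih]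
      filter_upwards [ae_mem_Ioo_betaMeasure θ 1] with x hx using hx.1
    filter_upwards [ih, hpos, hlim k] with ω h1 h2 h3
    have h4 := h3.pos_mul_atTop h2 (sum_tendsto k ω h1)
    rw [← tendsto_natCast_atTop_iff (R := ℝ)]
    refine (tendsto_atTop_add_const_left _ (-θ) h4).congr fun n => ?_
    have : (0 : ℝ) < θ + a n ω (k + 1) + ((max (a n ω k - a n ω (k + 1)) 1 : ℕ) : ℝ) := by
      positivity
    rw [meanRatio, div_mul_cancel₀ _ this.ne']
    ring

end Law

theorem tendsto_count_div {θ : ℝ} (hθ : 0 < θ) {a : ℕ → ℕ → ℕ} (ha : ∀ n, StrictUntilZero (a n))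
    {R : ℝ} {T : ℕ → ℝ} (h0 : Tendsto (fun n : ℕ => (a n 0 : ℝ) / (n + 1)) atTop (𝓝 R))
    (hT : ∀ k, Tendsto (fun n => meanRatio θ (a n) k) atTop (𝓝 (T k)))
    (hinf : ∀ k, Tendsto (fun n => a n k) atTop atTop) (k : ℕ) :
    Tendsto (fun n : ℕ => (a n k : ℝ) / (n + 1)) atTop (𝓝 (R * ∏ j ∈ Finset.range k, T j)) := by
  induction k with
  | zero => simpa using h0
  | succ k ih =>
    have h1 : Tendsto (fun n : ℕ => θ / ((n : ℝ) + 1)) atTop (𝓝 0) :=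
      (tendsto_atTop_add_const_right _ 1 tendsto_natCast_atTop_atTop).const_div_atTop θ
    have h2 := ((hT k).mul (h1.add ih)).sub h1
    rw [zero_add, sub_zero] at h2
    rw [Finset.prod_range_succ, ← mul_assoc, mul_comm _ (T k)]
    refine h2.congr' ?_
    filter_upwards [(hinf k).eventually_ge_atTop 1] with n hn
    have h3 := ha n k
    -- Once `a n k` is positive the counts are strictly decreasing there, so the maximum is the true
    -- difference and `meanRatio` is (θ + a_{k+1})/(θ + a_k).
    have h4 : a n (k + 1) + max (a n k - a n (k + 1)) 1 = a n k := by omega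
    have h5 : θ + (a n (k + 1) : ℝ) + ((max (a n k - a n (k + 1)) 1 : ℕ) : ℝ) = θ + a n k := by
      rw [add_assoc, ← Nat.cast_add, h4]
    have h6 : (0 : ℝ) < θ + a n k := by positivity
    have h7 : (0 : ℝ) < (n : ℝ) + 1 := by positivity
    rw [meanRatio, h5]
    field_simp
    ring

theorem ratioMoment_zero_exponents (θ : ℝ) (K : ℕ) (a : ℕ → ℕ) :
    ratioMoment θ K (fun _ => 0) a = 1 := by simp [ratioMoment]

theorem ratioMoment_single (θ : ℝ) (k p : ℕ) (a : ℕ → ℕ) :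
    ratioMoment θ (k + 1) (Pi.single k p) a =
      betaMoment (θ + a (k + 1)) ((max (a k - a (k + 1)) 1 : ℕ) : ℝ) p := by
  rw [ratioMoment, Finset.prod_eq_single k]
  · simp
  · intro j _ hj
    simp [Pi.single_eq_of_ne hj]
  · simp

/-! ### Existence, marginal laws and mixed moments of the limits. -/

section Limits

variable (θ ζ : ℝ)

theorem momentProcess_center (p n : ℕ) (ω : ∀ n : ℕ, Fin (n + 1)) :
    momentProcess θ ζ 0 p (fun _ => 0) (fun _ => 0) n ω =
      betaMoment (θ + lowerCount ω n 0) (ζ + upperCount ω n 0) p := by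
  simp [momentProcess, recordMoment, ratioMoment_zero_exponents]

theorem momentProcess_lower (k p n : ℕ) (ω : ∀ n : ℕ, Fin (n + 1)) :
    momentProcess θ ζ (k + 1) 0 (Pi.single k p) (fun _ => 0) n ω =
      betaMoment (θ + lowerCount ω n (k + 1))
        ((max (lowerCount ω n k - lowerCount ω n (k + 1)) 1 : ℕ) : ℝ) p := by
  rw [momentProcess, recordMoment, ratioMoment_zero_exponents, ratioMoment_single, betaMoment_zero,
    one_mul, mul_one]

theorem momentProcess_upper (k p n : ℕ) (ω : ∀ n : ℕ, Fin (n + 1)) :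
    momentProcess θ ζ (k + 1) 0 (fun _ => 0) (Pi.single k p) n ω =
      betaMoment (ζ + upperCount ω n (k + 1))
        ((max (upperCount ω n k - upperCount ω n (k + 1)) 1 : ℕ) : ℝ) p := by
  rw [momentProcess, recordMoment, ratioMoment_zero_exponents, ratioMoment_single, betaMoment_zero,
    one_mul, one_mul]

/-- The limit of the scaled center. -/
noncomputable def centerLimit (ω : ∀ n : ℕ, Fin (n + 1)) : ℝ :=
  limsup (fun n => momentProcess θ ζ 0 1 (fun _ => 0) (fun _ => 0) n ω) atTop

/-- The limit of the ratio of successive lower records. -/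
noncomputable def lowerLimit (k : ℕ) (ω : ∀ n : ℕ, Fin (n + 1)) : ℝ :=
  limsup (fun n => momentProcess θ ζ (k + 1) 0 (Pi.single k 1) (fun _ => 0) n ω) atTop

/-- The limit of the ratio of the distances of successive upper records from the top. -/
noncomputable def upperLimit (k : ℕ) (ω : ∀ n : ℕ, Fin (n + 1)) : ℝ :=
  limsup (fun n => momentProcess θ ζ (k + 1) 0 (fun _ => 0) (Pi.single k 1) n ω) atTop

theorem measurable_centerLimit : Measurable (centerLimit θ ζ) :=
  Measurable.limsup fun n => measurable_momentProcess _ _ _ _ n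

theorem measurable_lowerLimit (k : ℕ) : Measurable (lowerLimit θ ζ k) :=
  Measurable.limsup fun n => measurable_momentProcess _ _ _ _ n

theorem measurable_upperLimit (k : ℕ) : Measurable (upperLimit θ ζ k) :=
  Measurable.limsup fun n => measurable_momentProcess _ _ _ _ n

variable {θ ζ} (hθ : 0 < θ) (hζ : 0 < ζ)

theorem tendsto_momentProcess_limsup (K p : ℕ) (P Q : ℕ → ℕ) :
    ∀ᵐ ω ∂(ranksMeasure hθ hζ), Tendsto (fun n => momentProcess θ ζ K p P Q n ω) atTop
      (𝓝 (limsup (fun n => momentProcess θ ζ K p P Q n ω) atTop)) := by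
  filter_upwards [exists_tendsto_momentProcess hθ hζ K p P Q] with ω ⟨c, hc⟩
  rwa [hc.limsup_eq]

theorem tendsto_center : ∀ᵐ ω ∂(ranksMeasure hθ hζ),
    Tendsto (fun n => (θ + lowerCount ω n 0) / (θ + lowerCount ω n 0 + (ζ + upperCount ω n 0)))
      atTop (𝓝 (centerLimit θ ζ ω)) := by
  filter_upwards [tendsto_momentProcess_limsup hθ hζ 0 1 (fun _ => 0) (fun _ => 0)] with ω h
  exact h.congr fun n => by rw [momentProcess_center, betaMoment_one]

theorem tendsto_lower (k : ℕ) : ∀ᵐ ω ∂(ranksMeasure hθ hζ),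
    Tendsto (fun n => meanRatio θ (lowerCount ω n) k) atTop (𝓝 (lowerLimit θ ζ k ω)) := by
  filter_upwards [tendsto_momentProcess_limsup hθ hζ (k + 1) 0 (Pi.single k 1) (fun _ => 0)]
    with ω h
  exact h.congr fun n => by rw [momentProcess_lower, betaMoment_one, meanRatio]

theorem tendsto_upper (k : ℕ) : ∀ᵐ ω ∂(ranksMeasure hθ hζ),
    Tendsto (fun n => meanRatio ζ (upperCount ω n) k) atTop (𝓝 (upperLimit θ ζ k ω)) := by
  filter_upwards [tendsto_momentProcess_limsup hθ hζ (k + 1) 0 (fun _ => 0) (Pi.single k 1)]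
    with ω h
  exact h.congr fun n => by rw [momentProcess_upper, betaMoment_one, meanRatio]

theorem sum_center_eq (θ ζ : ℝ) (ω : ∀ n : ℕ, Fin (n + 1)) (n : ℕ) :
    θ + lowerCount ω n 0 + (ζ + upperCount ω n 0) = θ + ζ + n := by
  have : (lowerCount ω n 0 : ℝ) + upperCount ω n 0 = n := by
    exact_mod_cast lowerCount_add_upperCount ω n
  linarith

theorem tendsto_sum_center (θ ζ : ℝ) (ω : ∀ n : ℕ, Fin (n + 1)) :
    Tendsto (fun n => θ + (lowerCount ω n 0 : ℝ) + (ζ + upperCount ω n 0)) atTop atTop := by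
  simp only [sum_center_eq]
  exact tendsto_atTop_add_const_left _ _ tendsto_natCast_atTop_atTop

theorem map_centerLimit : (ranksMeasure hθ hζ).map (centerLimit θ ζ) = betaMeasure θ ζ := by
  refine map_eq_betaMeasure_of_tendsto hθ hζ (measurable_centerLimit θ ζ)
    (fun n ω => by positivity) (fun n ω => by positivity) (fun p n => ?_) (tendsto_center hθ hζ)
    (Eventually.of_forall fun ω => tendsto_sum_center θ ζ ω) fun p n => ?_
  · simp only [← momentProcess_center]
    exact measurable_momentProcess _ _ _ _ n
  · simp only [← momentProcess_center]
    rw [integral_momentProcess]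
    simp [recordMoment, ratioMoment_zero_exponents]

theorem centerLimit_mem_Ioo :
    ∀ᵐ ω ∂(ranksMeasure hθ hζ), centerLimit θ ζ ω ∈ Set.Ioo (0 : ℝ) 1 := by
  refine ae_of_ae_map (p := fun x => x ∈ Set.Ioo (0 : ℝ) 1)
    (measurable_centerLimit θ ζ).aemeasurable ?_
  rw [map_centerLimit]
  exact ae_mem_Ioo_betaMeasure θ ζ

theorem tendsto_lowerCount_zero :
    ∀ᵐ ω ∂(ranksMeasure hθ hζ), Tendsto (fun n => lowerCount ω n 0) atTop atTop := by
  filter_upwards [tendsto_center hθ hζ, centerLimit_mem_Ioo hθ hζ] with ω h1 h2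
  have h3 := h1.pos_mul_atTop h2.1 (tendsto_sum_center θ ζ ω)
  rw [← tendsto_natCast_atTop_iff (R := ℝ)]
  refine (tendsto_atTop_add_const_left _ (-θ) h3).congr fun n => ?_
  have : (0 : ℝ) < θ + lowerCount ω n 0 + (ζ + upperCount ω n 0) := by positivity
  rw [div_mul_cancel₀ _ this.ne']
  ring

theorem tendsto_upperCount_zero :
    ∀ᵐ ω ∂(ranksMeasure hθ hζ), Tendsto (fun n => upperCount ω n 0) atTop atTop := by
  filter_upwards [tendsto_center hθ hζ, centerLimit_mem_Ioo hθ hζ] with ω h1 h2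
  have h3 := (h1.const_sub 1).pos_mul_atTop (sub_pos.2 h2.2) (tendsto_sum_center θ ζ ω)
  rw [← tendsto_natCast_atTop_iff (R := ℝ)]
  refine (tendsto_atTop_add_const_left _ (-ζ) h3).congr fun n => ?_
  have : (0 : ℝ) < θ + lowerCount ω n 0 + (ζ + upperCount ω n 0) := by positivity
  rw [sub_mul, div_mul_cancel₀ _ this.ne']
  ring

theorem tendsto_lowerCount_and_map_lowerLimit (k : ℕ) :
    (∀ᵐ ω ∂(ranksMeasure hθ hζ), Tendsto (fun n => lowerCount ω n k) atTop atTop) ∧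
      (ranksMeasure hθ hζ).map (lowerLimit θ ζ k) = betaMeasure θ 1 := by
  refine tendsto_count_and_map_eq_betaMeasure hθ (a := fun n ω => lowerCount ω n)
    (measurable_lowerLimit θ ζ) (fun k p n => ?_) (tendsto_lower hθ hζ) (fun k p n => ?_)
    (tendsto_lowerCount_zero hθ hζ) k
  · simp only [← momentProcess_lower θ ζ]
    exact measurable_momentProcess _ _ _ _ n
  · simp only [← momentProcess_lower θ ζ]
    rw [integral_momentProcess]
    simp [recordMoment, ratioMoment_zero_exponents, ratioMoment_single]

theorem tendsto_upperCount_and_map_upperLimit (k : ℕ) :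
    (∀ᵐ ω ∂(ranksMeasure hθ hζ), Tendsto (fun n => upperCount ω n k) atTop atTop) ∧
      (ranksMeasure hθ hζ).map (upperLimit θ ζ k) = betaMeasure ζ 1 := by
  refine tendsto_count_and_map_eq_betaMeasure hζ (a := fun n ω => upperCount ω n)
    (measurable_upperLimit θ ζ) (fun k p n => ?_) (tendsto_upper hθ hζ) (fun k p n => ?_)
    (tendsto_upperCount_zero hθ hζ) k
  · simp only [← momentProcess_upper θ ζ]
    exact measurable_momentProcess _ _ _ _ n
  · simp only [← momentProcess_upper θ ζ]
    rw [integral_momentProcess]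
    simp [recordMoment, ratioMoment_zero_exponents, ratioMoment_single]

theorem tendsto_lowerCount_div : ∀ᵐ ω ∂(ranksMeasure hθ hζ), ∀ k,
    Tendsto (fun n : ℕ => (lowerCount ω n k : ℝ) / (n + 1)) atTop
      (𝓝 (centerLimit θ ζ ω * ∏ j ∈ Finset.range k, lowerLimit θ ζ j ω)) := by
  filter_upwards [tendsto_center hθ hζ, ae_all_iff.2 (tendsto_lower hθ hζ),
    ae_all_iff.2 fun k => (tendsto_lowerCount_and_map_lowerLimit hθ hζ k).1] with ω h1 h2 h3
  refine tendsto_count_div hθ (strictUntilZero_lowerCount ω) ?_ h2 h3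
  have hn : Tendsto (fun n : ℕ => (n : ℝ) + 1) atTop atTop :=
    tendsto_atTop_add_const_right _ 1 tendsto_natCast_atTop_atTop
  have e1 : Tendsto (fun n : ℕ => θ / ((n : ℝ) + 1)) atTop (𝓝 0) := hn.const_div_atTop θ
  -- The correction factor is (θ + ζ + n)/(n + 1) = 1 + (θ + ζ − 1)/(n + 1), which changes the
  -- denominator of the posterior mean into n + 1.
  have e2 : Tendsto (fun n : ℕ => (θ + ζ - 1) / ((n : ℝ) + 1)) atTop (𝓝 0) := hn.const_div_atTop _
  have h4 := (h1.mul (e2.const_add 1)).sub e1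
  rw [add_zero, mul_one, sub_zero] at h4
  refine h4.congr fun n => ?_
  have h5 : (0 : ℝ) < (n : ℝ) + 1 := by positivity
  have h6 : (0 : ℝ) < θ + ζ + n := by positivity
  rw [sum_center_eq]
  field_simp
  ring

theorem tendsto_upperCount_div : ∀ᵐ ω ∂(ranksMeasure hθ hζ), ∀ k,
    Tendsto (fun n : ℕ => (upperCount ω n k : ℝ) / (n + 1)) atTop
      (𝓝 ((1 - centerLimit θ ζ ω) * ∏ j ∈ Finset.range k, upperLimit θ ζ j ω)) := by
  filter_upwards [tendsto_lowerCount_div hθ hζ, ae_all_iff.2 (tendsto_upper hθ hζ),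
    ae_all_iff.2 fun k => (tendsto_upperCount_and_map_upperLimit hθ hζ k).1] with ω h1 h2 h3
  refine tendsto_count_div hζ (strictUntilZero_upperCount ω) ?_ h2 h3
  have hn : Tendsto (fun n : ℕ => (n : ℝ) + 1) atTop atTop :=
    tendsto_atTop_add_const_right _ 1 tendsto_natCast_atTop_atTop
  have e1 : Tendsto (fun n : ℕ => 1 / ((n : ℝ) + 1)) atTop (𝓝 0) := hn.const_div_atTop 1
  have h4 := (((h1 0).const_sub 1).sub e1)
  rw [Finset.prod_range_zero, mul_one, sub_zero] at h4
  refine h4.congr fun n => ?_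
  have h5 : (0 : ℝ) < (n : ℝ) + 1 := by positivity
  have h6 : (lowerCount ω n 0 : ℝ) + upperCount ω n 0 = n := by
    exact_mod_cast lowerCount_add_upperCount ω n
  field_simp
  linarith

theorem tendsto_ratioMoment {ξ : ℝ} {a : ℕ → ℕ → ℕ} {T : ℕ → ℝ}
    (hξ : 0 < ξ) (hT : ∀ k, Tendsto (fun n => meanRatio ξ (a n) k) atTop (𝓝 (T k)))
    (hinf : ∀ k, Tendsto (fun n => a n k) atTop atTop) (K : ℕ) (P : ℕ → ℕ) :
    Tendsto (fun n => ratioMoment ξ K P (a n)) atTop (𝓝 (∏ j ∈ Finset.range K, T j ^ P j)) := by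
  refine tendsto_finsetProd _ fun j _ => tendsto_betaMoment (hT j) ?_ _
  refine tendsto_atTop_mono (fun n => ?_) (tendsto_natCast_atTop_atTop.comp (hinf (j + 1)))
  have : (0 : ℝ) ≤ ((max (a n j - a n (j + 1)) 1 : ℕ) : ℝ) := Nat.cast_nonneg _
  simp only [Function.comp_apply]
  linarith

/-- The mixed moments of the limits. -/
theorem integral_prod_limits (K p : ℕ) (P Q : ℕ → ℕ) :
    ∫ ω, centerLimit θ ζ ω ^ p * (∏ j ∈ Finset.range K, lowerLimit θ ζ j ω ^ P j) *
      ∏ j ∈ Finset.range K, upperLimit θ ζ j ω ^ Q j ∂(ranksMeasure hθ hζ) =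
    betaMoment θ ζ p * (∏ j ∈ Finset.range K, betaMoment θ 1 (P j)) *
      ∏ j ∈ Finset.range K, betaMoment ζ 1 (Q j) := by
  refine tendsto_nhds_unique
    (f := fun n : ℕ => ∫ ω, momentProcess θ ζ K p P Q n ω ∂(ranksMeasure hθ hζ)) (l := atTop) ?_ ?_
  · refine tendsto_integral_of_dominated_convergence (fun _ => 1)
      (fun n => (measurable_momentProcess K p P Q n).aestronglyMeasurable) (integrable_const 1)
      (fun n => Eventually.of_forall fun ω => ?_) ?_
    · have h := momentProcess_mem_Icc hθ hζ K p P Q n ω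
      rw [Real.norm_eq_abs, abs_of_nonneg h.1]
      exact h.2
    · filter_upwards [tendsto_center hθ hζ, ae_all_iff.2 (tendsto_lower hθ hζ),
        ae_all_iff.2 (tendsto_upper hθ hζ),
        ae_all_iff.2 fun k => (tendsto_lowerCount_and_map_lowerLimit hθ hζ k).1,
        ae_all_iff.2 fun k => (tendsto_upperCount_and_map_upperLimit hθ hζ k).1]
        with ω h1 h2 h3 h4 h5
      exact ((tendsto_betaMoment h1 (tendsto_sum_center θ ζ ω) p).mul
        (tendsto_ratioMoment hθ h2 h4 K P)).mul (tendsto_ratioMoment hζ h3 h5 K Q)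
  · simp only [integral_momentProcess]
    have : recordMoment θ ζ K p P Q (fun _ => 0) (fun _ => 0) =
        betaMoment θ ζ p * (∏ j ∈ Finset.range K, betaMoment θ 1 (P j)) *
          ∏ j ∈ Finset.range K, betaMoment ζ 1 (Q j) := by
      simp [recordMoment, ratioMoment]
    rw [this]
    exact tendsto_const_nhds

end Limits

/-! ### Joint independence of the center and the ratios. -/

section JointLaw

variable {θ ζ : ℝ}

/-- The center limit and the ratio limits, as one family. -/
noncomputable def limitFamily (θ ζ : ℝ) : Unit ⊕ (ℕ ⊕ ℕ) → (∀ n : ℕ, Fin (n + 1)) → ℝ :=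
  Sum.elim (fun _ => centerLimit θ ζ) (Sum.elim (lowerLimit θ ζ) (upperLimit θ ζ))

/-- The laws of the members of `limitFamily`. -/
noncomputable def limitLaw (θ ζ : ℝ) : Unit ⊕ (ℕ ⊕ ℕ) → Measure ℝ :=
  Sum.elim (fun _ => betaMeasure θ ζ)
    (Sum.elim (fun _ => betaMeasure θ 1) (fun _ => betaMeasure ζ 1))

theorem isProbabilityMeasure_limitLaw (hθ : 0 < θ) (hζ : 0 < ζ) (i : Unit ⊕ (ℕ ⊕ ℕ)) :
    IsProbabilityMeasure (limitLaw θ ζ i) := by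
  rcases i with _ | _ | _
  · exact isProbabilityMeasureBeta hθ hζ
  · exact isProbabilityMeasureBeta hθ one_pos
  · exact isProbabilityMeasureBeta hζ one_pos

theorem ae_mem_Ioo_limitLaw (i : Unit ⊕ (ℕ ⊕ ℕ)) :
    ∀ᵐ x ∂(limitLaw θ ζ i), x ∈ Set.Ioo (0 : ℝ) 1 := by
  rcases i with _ | _ | _ <;> exact ae_mem_Ioo_betaMeasure _ _

theorem measurable_limitFamily (i : Unit ⊕ (ℕ ⊕ ℕ)) : Measurable (limitFamily θ ζ i) := by
  rcases i with _ | j | j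
  · exact measurable_centerLimit θ ζ
  · exact measurable_lowerLimit θ ζ j
  · exact measurable_upperLimit θ ζ j

theorem map_limitFamily (hθ : 0 < θ) (hζ : 0 < ζ) (i : Unit ⊕ (ℕ ⊕ ℕ)) :
    (ranksMeasure hθ hζ).map (limitFamily θ ζ i) = limitLaw θ ζ i := by
  rcases i with _ | j | j
  · exact map_centerLimit hθ hζ
  · exact (tendsto_lowerCount_and_map_lowerLimit hθ hζ j).2
  · exact (tendsto_upperCount_and_map_upperLimit hθ hζ j).2

/-- Puts an arbitrary finite monomial into the shape of `integral_prod_limits`, where both sides use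
the same range; the added factors have exponent 0. -/
theorem exists_prod_eq_prod_range (s : Finset (Unit ⊕ (ℕ ⊕ ℕ))) :
    ∃ K : ℕ, ∀ f : Unit ⊕ (ℕ ⊕ ℕ) → ℝ, (∀ i ∉ s, f i = 1) →
      ∏ i ∈ s, f i = f (Sum.inl ()) * (∏ j ∈ Finset.range K, f (Sum.inr (Sum.inl j))) *
        ∏ j ∈ Finset.range K, f (Sum.inr (Sum.inr j)) := by
  let b : Unit ⊕ (ℕ ⊕ ℕ) → ℕ := Sum.elim (fun _ => 0) (Sum.elim (· + 1) (· + 1))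
  refine ⟨s.sup b, fun f hf => ?_⟩
  have hs : s ⊆ (Finset.univ : Finset Unit).disjSum
      ((Finset.range (s.sup b)).disjSum (Finset.range (s.sup b))) := by
    intro i hi
    have := Finset.le_sup (f := b) hi
    rcases i with _ | j | j
    · simp
    · simpa [b] using this
    · simpa [b] using this
  rw [Finset.prod_subset hs fun i _ hi => hf i hi, Finset.prod_disjSum, Finset.prod_disjSum,
    mul_assoc]
  simp

/-- All variables lie in the unit interval, and the mixed moments of the limits factor into those of
the beta marginals, so the moment criterion applies. -/
theorem map_limitFamily_eq_infinitePi (hθ : 0 < θ) (hζ : 0 < ζ) :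
    (ranksMeasure hθ hζ).map (fun ω i => limitFamily θ ζ i ω) =
      Measure.infinitePi (limitLaw θ ζ) := by
  have := isProbabilityMeasure_limitLaw hθ hζ
  have hX : Measurable fun ω i => limitFamily θ ζ i ω := measurable_pi_iff.2 measurable_limitFamily
  have := Measure.isProbabilityMeasure_map (μ := ranksMeasure hθ hζ) hX.aemeasurable
  refine measure_ext_of_moments ?_ ?_ fun d => ?_
  · rw [ae_all_iff]
    intro i
    have h1 : ∀ᵐ ω ∂(ranksMeasure hθ hζ), limitFamily θ ζ i ω ∈ Set.Ioo (0 : ℝ) 1 := by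
      refine ae_of_ae_map (p := fun x => x ∈ Set.Ioo (0 : ℝ) 1)
        (measurable_limitFamily i).aemeasurable ?_
      rw [map_limitFamily]
      exact ae_mem_Ioo_limitLaw i
    refine (ae_map_iff hX.aemeasurable
      (measurableSet_Icc.preimage (measurable_pi_apply i))).2 ?_
    filter_upwards [h1] with ω h using Set.Ioo_subset_Icc_self h
  · rw [ae_all_iff]
    intro i
    refine ae_of_ae_map (f := fun x : Unit ⊕ (ℕ ⊕ ℕ) → ℝ => x i)
      (p := fun x => x ∈ Set.Icc (0 : ℝ) 1) (measurable_pi_apply i).aemeasurable ?_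
    rw [Measure.infinitePi_map_eval]
    filter_upwards [ae_mem_Ioo_limitLaw i] with x h using Set.Ioo_subset_Icc_self h
  · have hm : Measurable fun x : Unit ⊕ (ℕ ⊕ ℕ) → ℝ => ∏ i ∈ d.support, x i ^ d i := by fun_prop
    obtain ⟨K, hK⟩ := exists_prod_eq_prod_range d.support
    rw [integral_map hX.aemeasurable hm.aestronglyMeasurable, integral_prod_infinitePi,
      hK _ fun i hi => by rw [Finsupp.notMem_support_iff.1 hi]; simp]
    have e : ∀ ω, ∏ i ∈ d.support, limitFamily θ ζ i ω ^ d i =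
        centerLimit θ ζ ω ^ d (Sum.inl ()) *
          (∏ j ∈ Finset.range K, lowerLimit θ ζ j ω ^ d (Sum.inr (Sum.inl j))) *
          ∏ j ∈ Finset.range K, upperLimit θ ζ j ω ^ d (Sum.inr (Sum.inr j)) := fun ω =>
      hK (fun i => limitFamily θ ζ i ω ^ d i) fun i hi => by
        rw [Finsupp.notMem_support_iff.1 hi, pow_zero]
    simp only [e]
    rw [integral_prod_limits hθ hζ K (d (Sum.inl ())) (fun j => d (Sum.inr (Sum.inl j)))
      (fun j => d (Sum.inr (Sum.inr j)))]
    simp only [limitLaw, Sum.elim_inl, Sum.elim_inr, integral_pow_betaMeasure hθ hζ,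
      integral_pow_betaMeasure hθ one_pos, integral_pow_betaMeasure hζ one_pos]

end JointLaw

/-! ### Transfer from rank sequences to coherent permutations. -/

/-- The zero-based initial ranks of a coherent sequence. -/
def CoherentPerms.ranks (π : CoherentPerms) (n : ℕ) : Fin (n + 1) :=
  π.perm (n + 1) (Fin.last n)

theorem CoherentPerms.ranks_ofRanks (r : ∀ n : ℕ, Fin (n + 1)) :
    (CoherentPerms.ofRanks r).ranks = r :=
  funext fun n => permOfRanks_last r n

theorem CoherentPerms.measurable_perm (n : ℕ) :
    Measurable fun π : CoherentPerms => π.perm n :=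
  (measurable_pi_apply n).comp measurable_subtype_coe

theorem CoherentPerms.measurable_ranks : Measurable CoherentPerms.ranks :=
  measurable_pi_iff.2 fun n =>
    (measurable_of_countable fun σ : Equiv.Perm (Fin (n + 1)) => σ (Fin.last n)).comp
      (CoherentPerms.measurable_perm (n + 1))

theorem map_ranks_recordMeasure {θ ζ : ℝ} (hθ : 0 < θ) (hζ : 0 < ζ) :
    (recordMeasure hθ hζ).map CoherentPerms.ranks = ranksMeasure hθ hζ := by
  rw [recordMeasure, Measure.map_map CoherentPerms.measurable_ranks
    CoherentPerms.measurable_ofRanks]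
  have : CoherentPerms.ranks ∘ CoherentPerms.ofRanks = id :=
    funext CoherentPerms.ranks_ofRanks
  rw [this, Measure.map_id]
  rfl

/-- The limits of the scaled records as functions of the center and of the ratio limits. -/
noncomputable def recordLimit (x : ℝ) (t z : ℕ → ℝ) : ℤ → ℝ
  | Int.ofNat k => 1 - (1 - x) * ∏ j ∈ Finset.range k, z j
  | Int.negSucc k => x * ∏ j ∈ Finset.range (k + 1), t j

theorem recordLimit_zero (x : ℝ) (t z : ℕ → ℝ) : recordLimit x t z 0 = x := by
  change 1 - (1 - x) * ∏ j ∈ Finset.range 0, z j = x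
  simp

theorem recordLimit_neg (x : ℝ) (t z : ℕ → ℝ) (k : ℕ) :
    recordLimit x t z (-((k : ℤ) + 1)) = x * ∏ j ∈ Finset.range (k + 1), t j := by
  rw [← Int.negSucc_eq]
  rfl

theorem recordLimit_natCast (x : ℝ) (t z : ℕ → ℝ) (k : ℕ) :
    recordLimit x t z (k : ℤ) = 1 - (1 - x) * ∏ j ∈ Finset.range k, z j := rfl

theorem measurable_recordLimit (k : ℤ) :
    Measurable fun p : ℝ × (ℕ → ℝ) × (ℕ → ℝ) => recordLimit p.1 p.2.1 p.2.2 k := by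
  rcases k with k | k
  · change Measurable fun p : ℝ × (ℕ → ℝ) × (ℕ → ℝ) => 1 - (1 - p.1) * ∏ j ∈ Finset.range k, p.2.2 j
    fun_prop
  · change Measurable fun p : ℝ × (ℕ → ℝ) × (ℕ → ℝ) => p.1 * ∏ j ∈ Finset.range (k + 1), p.2.1 j
    fun_prop

theorem tendsto_recordValue_div {θ ζ : ℝ} (hθ : 0 < θ) (hζ : 0 < ζ) (k : ℤ) :
    ∀ᵐ ω ∂(ranksMeasure hθ hζ),
      Tendsto (fun n : ℕ => (recordValue (permOfRanks ω n) k : ℝ) / (n : ℝ)) atTop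
        (𝓝 (recordLimit (centerLimit θ ζ ω) (fun j => lowerLimit θ ζ j ω)
          (fun j => upperLimit θ ζ j ω) k)) := by
  have hn : Tendsto (fun n : ℕ => 1 / ((n : ℝ) + 1)) atTop (𝓝 0) :=
    (tendsto_atTop_add_const_right _ 1 tendsto_natCast_atTop_atTop).const_div_atTop 1
  filter_upwards [tendsto_lowerCount_div hθ hζ, tendsto_upperCount_div hθ hζ] with ω h1 h2
  -- The counts at index `n` describe the permutation of n + 1 elements.
  rw [← tendsto_add_atTop_iff_nat 1]
  rcases k with k | k
  · refine ((h2 k).const_sub 1).congr fun n => ?_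
    have h3 : (recordValue (permOfRanks ω (n + 1)) (Int.ofNat k) : ℝ) + upperCount ω n k =
        n + 1 := by exact_mod_cast recordValue_nonneg ω n k
    have h4 : (0 : ℝ) < (n : ℝ) + 1 := by positivity
    push_cast
    field_simp
    linarith
  · have h5 := (h1 (k + 1)).add hn
    rw [add_zero] at h5
    refine h5.congr fun n => ?_
    rw [Int.negSucc_eq, recordValue_neg, ← add_div]
    push_cast
    rfl

/-- In an independent family `R, T_k, Z_k`, the pair of `R` and `(T_k)` is independent of `(Z_k)`. -/
theorem indepFun_prodMk_of_iIndepFun {Ω : Type*} [MeasurableSpace Ω] {μ : Measure Ω} {R : Ω → ℝ}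
    {T Z : ℕ → Ω → ℝ} (hR : Measurable R) (hT : ∀ k, Measurable (T k)) (hZ : ∀ k, Measurable (Z k))
    (h : iIndepFun (β := fun _ : Unit ⊕ (ℕ ⊕ ℕ) => ℝ)
      (Sum.elim (fun _ => R) (Sum.elim T Z)) μ) :
    IndepFun (fun ω => (R ω, fun k => T k ω)) (fun ω k => Z k ω) μ := by
  let m : Unit ⊕ (ℕ ⊕ ℕ) → MeasurableSpace Ω := fun i =>
    MeasurableSpace.comap ((Sum.elim (fun _ => R) (Sum.elim T Z) :
      Unit ⊕ (ℕ ⊕ ℕ) → Ω → ℝ) i) inferInstance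
  let A : Set (Unit ⊕ (ℕ ⊕ ℕ)) := {i | ∀ j, i ≠ Sum.inr (Sum.inr j)}
  let B : Set (Unit ⊕ (ℕ ⊕ ℕ)) := {i | ∃ j, i = Sum.inr (Sum.inr j)}
  have hAB : Disjoint A B := by
    rw [Set.disjoint_left]
    rintro i hi ⟨j, hj⟩
    exact hi j hj
  have hm : ∀ i, m i ≤ ‹MeasurableSpace Ω› := by
    rintro (_ | j | j)
    · exact hR.comap_le
    · exact (hT j).comap_le
    · exact (hZ j).comap_le
  have hind : Indep (⨆ i ∈ A, m i) (⨆ i ∈ B, m i) μ := indep_iSup_of_disjoint hm h hAB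
  have hle : ∀ (C : Set (Unit ⊕ (ℕ ⊕ ℕ))) i, i ∈ C →
      Measurable[⨆ i ∈ C, m i] ((Sum.elim (fun _ => R) (Sum.elim T Z) :
        Unit ⊕ (ℕ ⊕ ℕ) → Ω → ℝ) i) := fun C i hi =>
    Measurable.mono (comap_measurable _) (le_iSup₂_of_le (f := fun i _ => m i) i hi le_rfl) le_rfl
  refine indep_of_indep_of_le_left (indep_of_indep_of_le_right hind ?_) ?_
  · refine Measurable.comap_le ?_
    refine @measurable_pi_lambda _ _ _ (⨆ i ∈ B, m i) _ _ fun j => ?_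
    exact hle B (Sum.inr (Sum.inr j)) ⟨j, rfl⟩
  · refine Measurable.comap_le ?_
    refine @Measurable.prodMk Ω (⨆ i ∈ A, m i) ℝ (ℕ → ℝ) _ _ R (fun ω k => T k ω) ?_ ?_
    · exact hle A (Sum.inl ()) (by simp [A])
    · refine @measurable_pi_lambda _ _ _ (⨆ i ∈ A, m i) _ _ fun j => ?_
      exact hle A (Sum.inr (Sum.inl j)) (by simp [A])

theorem proposition6p1 (θ ζ : ℝ) (hθ : 0 < θ) (hζ : 0 < ζ) :
    ∃ (ρ : ℤ → CoherentPerms → ℝ) (hρ : ∀ k, Measurable (ρ k)),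
      -- the scaled record values converge almost surely
      (∀ k : ℤ, ∀ᵐ π ∂(recordMeasure hθ hζ),
        Tendsto (fun n : ℕ => (recordValue (π.perm n) k : ℝ) / (n : ℝ)) atTop (𝓝 (ρ k π))) ∧
      -- the law of `ρ_0`
      (recordMeasure hθ hζ).map (ρ 0) = betaMeasure θ ζ ∧
      -- given `ρ_0`, the sequences `(ρ_k, k < 0)` and `(ρ_k, k > 0)` are independent
      CondIndepFun (MeasurableSpace.comap (ρ 0) inferInstance) (hρ 0).comap_le
        (fun π (k : ℕ) => ρ (-((k : ℤ) + 1)) π) (fun π (k : ℕ) => ρ ((k : ℤ) + 1) π)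
        (recordMeasure hθ hζ) ∧
      -- stick-breaking representation; `T k`, `Z k` stand for `T_{-(k+1)}`, `Z_{k+1}`
      ∃ T Z : ℕ → CoherentPerms → ℝ,
        (∀ k, Measurable (T k)) ∧ (∀ k, Measurable (Z k)) ∧
        (∀ k, (recordMeasure hθ hζ).map (T k) = betaMeasure θ 1) ∧
        (∀ k, (recordMeasure hθ hζ).map (Z k) = betaMeasure ζ 1) ∧
        iIndepFun (β := fun _ : Unit ⊕ (ℕ ⊕ ℕ) => ℝ)
          (Sum.elim (fun _ => ρ 0) (Sum.elim T Z)) (recordMeasure hθ hζ) ∧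
        (∀ k : ℕ, ∀ᵐ π ∂(recordMeasure hθ hζ),
          ρ (-((k : ℤ) + 1)) π = ρ 0 π * ∏ j ∈ Finset.range (k + 1), T j π) ∧
        (∀ k : ℕ, ∀ᵐ π ∂(recordMeasure hθ hζ),
          ρ ((k : ℤ) + 1) π = 1 - (1 - ρ 0 π) * ∏ j ∈ Finset.range (k + 1), Z j π) := by
  let R : CoherentPerms → ℝ := fun π => centerLimit θ ζ π.ranks
  let T : ℕ → CoherentPerms → ℝ := fun k π => lowerLimit θ ζ k π.ranks
  let Z : ℕ → CoherentPerms → ℝ := fun k π => upperLimit θ ζ k π.ranks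
  let ρ : ℤ → CoherentPerms → ℝ := fun k π => recordLimit (R π) (fun j => T j π) (fun j => Z j π) k
  have hr := CoherentPerms.measurable_ranks
  have hR : Measurable R := (measurable_centerLimit θ ζ).comp hr
  have hT : ∀ k, Measurable (T k) := fun k => (measurable_lowerLimit θ ζ k).comp hr
  have hZ : ∀ k, Measurable (Z k) := fun k => (measurable_upperLimit θ ζ k).comp hr
  have hρ : ∀ k, Measurable (ρ k) := fun k => (measurable_recordLimit k).comp
    (hR.prodMk ((measurable_pi_iff.2 hT).prodMk (measurable_pi_iff.2 hZ)))
  have hρ0 : ρ 0 = R := funext fun π => recordLimit_zero _ _ _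
  have hmap : ∀ {f : (∀ n : ℕ, Fin (n + 1)) → ℝ}, Measurable f →
      (recordMeasure hθ hζ).map (fun π => f π.ranks) = (ranksMeasure hθ hζ).map f := fun hf => by
    rw [← map_ranks_recordMeasure hθ hζ, Measure.map_map hf hr]
    rfl
  have hmapR : (recordMeasure hθ hζ).map R = betaMeasure θ ζ := by
    rw [hmap (measurable_centerLimit θ ζ), map_centerLimit]
  have hmapT : ∀ k, (recordMeasure hθ hζ).map (T k) = betaMeasure θ 1 := fun k => by
    rw [hmap (measurable_lowerLimit θ ζ k), (tendsto_lowerCount_and_map_lowerLimit hθ hζ k).2]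
  have hmapZ : ∀ k, (recordMeasure hθ hζ).map (Z k) = betaMeasure ζ 1 := fun k => by
    rw [hmap (measurable_upperLimit θ ζ k), (tendsto_upperCount_and_map_upperLimit hθ hζ k).2]
  have hind : iIndepFun (β := fun _ : Unit ⊕ (ℕ ⊕ ℕ) => ℝ)
      (Sum.elim (fun _ => R) (Sum.elim T Z)) (recordMeasure hθ hζ) := by
    have e : (Sum.elim (fun _ => R) (Sum.elim T Z) : Unit ⊕ (ℕ ⊕ ℕ) → CoherentPerms → ℝ) =
        fun i π => limitFamily θ ζ i π.ranks := by
      funext i π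
      rcases i with _ | _ | _ <;> rfl
    have hX : Measurable fun ω i => limitFamily θ ζ i ω :=
      measurable_pi_iff.2 measurable_limitFamily
    have hXr : ∀ i, Measurable fun π : CoherentPerms => limitFamily θ ζ i π.ranks := fun i =>
      (measurable_limitFamily i).comp hr
    rw [e, iIndepFun_iff_map_fun_eq_infinitePi_map hXr]
    have h1 : (recordMeasure hθ hζ).map (fun π i => limitFamily θ ζ i π.ranks) =
        (ranksMeasure hθ hζ).map fun ω i => limitFamily θ ζ i ω := by
      rw [← map_ranks_recordMeasure hθ hζ, Measure.map_map hX hr]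
      rfl
    rw [h1, map_limitFamily_eq_infinitePi]
    congr 1
    funext i
    rw [hmap (measurable_limitFamily i), map_limitFamily]
  refine ⟨ρ, hρ, fun k => ?_, by rw [hρ0, hmapR], ?_, T, Z, hT, hZ, hmapT, hmapZ,
    by rw [hρ0]; exact hind, fun k => ?_, fun k => ?_⟩
  · have hm : ∀ n : ℕ, Measurable fun π : CoherentPerms =>
        (recordValue (π.perm n) k : ℝ) / (n : ℝ) := fun n =>
      (measurable_of_countable fun σ : Equiv.Perm (Fin n) => (recordValue σ k : ℝ) / (n : ℝ)).comp
        (CoherentPerms.measurable_perm n)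
    -- The convergence event is measurable, so the almost sure statement can be checked on rank
    -- sequences.
    refine (ae_map_iff CoherentPerms.measurable_ofRanks.aemeasurable
      (measurableSet_tendsto_fun hm (hρ k))).2 ?_
    filter_upwards [tendsto_recordValue_div hθ hζ k] with ω h
    simp only [ρ, R, T, Z, CoherentPerms.ranks_ofRanks]
    exact h
  · have h1 := condIndepFun_of_indepFun_prodMk hR (measurable_pi_iff.2 hT) (measurable_pi_iff.2 hZ)
      (indepFun_prodMk_of_iIndepFun hR hT hZ hind)
      (G := fun p : ℝ × (ℕ → ℝ) => fun k : ℕ => p.1 * ∏ j ∈ Finset.range (k + 1), p.2 j)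
      (by fun_prop)
      (F := fun p : ℝ × (ℕ → ℝ) => fun k : ℕ => 1 - (1 - p.1) * ∏ j ∈ Finset.range (k + 1), p.2 j)
      (by fun_prop)
    have e1 : (fun π (k : ℕ) => ρ (-((k : ℤ) + 1)) π) =
        fun π k => R π * ∏ j ∈ Finset.range (k + 1), T j π := by
      funext π k
      exact recordLimit_neg _ _ _ k
    have e2 : (fun π (k : ℕ) => ρ ((k : ℤ) + 1) π) =
        fun π k => 1 - (1 - R π) * ∏ j ∈ Finset.range (k + 1), Z j π := by
      funext π k
      exact recordLimit_natCast _ _ _ (k + 1)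
    rw [e1, e2]
    simp only [hρ0]
    exact h1
  · refine Eventually.of_forall fun π => ?_
    rw [hρ0]
    exact recordLimit_neg _ _ _ k
  · refine Eventually.of_forall fun π => ?_
    rw [hρ0]
    exact recordLimit_natCast _ _ _ (k + 1)
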